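/- All graphs are finite and simple; $\overline G$ is the complement of $G$, $G+H$ is the disjoint union, and $nG$ is the disjoint union of $n$ copies of $G$. A graph $G$ is *polar* if its vertex set has a partition into two (possibly empty) sets $A,B$ such that $G[A]$ is a complete multipartite graph and $G[B]$ is a cluster (the complement of a complete multipartite graph). A *minimal polar obstruction* is a graph that is not polar but all of whose proper induced subgraphs are polar. A graph $G$ is *$P_4$-extendible* if, for every vertex set $W$ inducing a $P_4$ in $G$, at most one vertex outside $W$ belongs to an induced $P_4$ of $G$ that shares a vertex with $W$. Theorem. If $H$ is a $P_4$-extendible minimal polar obstruction, then $H$ or its complement $\overline H$ is isomorphic to $P_3+\overline{E}$, where $E$ is one of the seven graphs $$K_1+2K_2,\quad 2P_3,\quad C_4+2K_1,\quad K_1+\overline{P_3+K_2},\quad K_1+C_5,\quad K_1+P,\quad K_1+\overline{P_5}.$$ Here $P_n$ and $C_n$ are the path and the cycle on $n$ vertices, and $P$ is the banner, i.e. the graph obtained from $C_4$ by attaching one pendant vertex to one of its vertices. -/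

import Mathlib

/-- `G` is polar: its vertex set has a partition into sets `A` and `B` (possibly empty) such that
`G[A]` is a complete multipartite graph and `G[B]` is a cluster, i.e. the complement of a complete
multipartite graph, both with an unrestricted number of parts. -/
def IsPolar {V : Type*} (G : SimpleGraph V) : Prop :=
  ∃ A B : Set V, Disjoint A B ∧ A ∪ B = Set.univ ∧
    (G.induce A).IsCompleteMultipartite ∧ ((G.induce B)ᶜ).IsCompleteMultipartite

/-- `G` is not polar, but every proper induced subgraph of `G` is polar. -/
def IsMinimalPolarObstruction {V : Type*} (G : SimpleGraph V) : Prop :=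
  ¬ IsPolar G ∧ ∀ S : Set V, S ≠ Set.univ → IsPolar (G.induce S)

/-- The vertex set `W` induces a path on four vertices in `G`. -/
def InducesP4 {V : Type*} (G : SimpleGraph V) (W : Set V) : Prop :=
  Nonempty (G.induce W ≃g SimpleGraph.pathGraph 4)

/-- `G` is `P₄`-extendible: for every `W` inducing a `P₄`, at most one vertex outside `W` belongs
to an induced `P₄` of `G` that shares vertices with `W`. -/
def IsP4Extendible {V : Type*} (G : SimpleGraph V) : Prop :=
  ∀ W : Set V, InducesP4 G W →
    {v : V | v ∉ W ∧ ∃ U : Set V, InducesP4 G U ∧ v ∈ U ∧ (U ∩ W).Nonempty}.Subsingleton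

/-- The banner `P`: the cycle on `0, 1, 2, 3` with a pendant vertex `4` attached to `0`. -/
def bannerGraph : SimpleGraph (Fin 5) :=
  SimpleGraph.fromEdgeSet {s(0, 1), s(1, 2), s(2, 3), s(3, 0), s(0, 4)}

/-- `G` is isomorphic to one of the seven graphs `K₁ + 2K₂`, `2P₃`, `C₄ + 2K₁`,
the disjoint union of `K₁` and the complement of `P₃ + K₂`, `K₁ + C₅`, `K₁ + P` with `P` the banner,
and the disjoint union of `K₁` and the complement of `P₅`. -/
def IsEssentialGraph {V : Type*} (G : SimpleGraph V) : Prop :=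
  Nonempty (G ≃g SimpleGraph.completeGraph (Fin 1) ⊕g (SimpleGraph.completeGraph (Fin 2) ⊕g SimpleGraph.completeGraph (Fin 2))) ∨
  Nonempty (G ≃g SimpleGraph.pathGraph 3 ⊕g SimpleGraph.pathGraph 3) ∨
  Nonempty (G ≃g SimpleGraph.cycleGraph 4 ⊕g
    (SimpleGraph.completeGraph (Fin 1) ⊕g SimpleGraph.completeGraph (Fin 1))) ∨
  Nonempty (G ≃g SimpleGraph.completeGraph (Fin 1) ⊕g
    (SimpleGraph.pathGraph 3 ⊕g SimpleGraph.completeGraph (Fin 2))ᶜ) ∨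
  Nonempty (G ≃g SimpleGraph.completeGraph (Fin 1) ⊕g SimpleGraph.cycleGraph 5) ∨
  Nonempty (G ≃g SimpleGraph.completeGraph (Fin 1) ⊕g bannerGraph) ∨
  Nonempty (G ≃g SimpleGraph.completeGraph (Fin 1) ⊕g (SimpleGraph.pathGraph 5)ᶜ)

/-! Polarity is invariant under complementation. If $H$ and $\overline H$ are both connected,
extendibility forces a rigid shape (`IsSpread`): either at most five vertices, or a $P_4$ with at
most one extra vertex, a twin of a path vertex, while the set $R$ of all other vertices is joined to
the midpoints and misses the endpoints. By minimality $R$ is polar. Adding the midpoints to its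
multipartite part and the endpoints to its cluster makes $H$ polar (`IsSpread.polarOn`), a
contradiction. So $H$ or $\overline H$ is disconnected.

Call a graph monopolar if it splits into an independent set and a cluster. Disjoint unions preserve
this, so a disconnected obstruction has a non-monopolar side $X$. The other side contains a $P_3$,
since otherwise it could be added to the cluster of a polar partition of $X$. Beside a $P_3$, every
polar partition of a part of $X$ is monopolar. Minimality therefore gives $H = P_3 + X$ with $X$
minimal non-monopolar (`IsExtendible.exists_iso_sum`).

It remains to see that $X\cong\overline E$ (`IsExtendible.exists_iso_compl`). Minimality makes $X$
connected. An essential graph is found in $\overline X$ by `containsEssential_of_cut` if $\overline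
X$ is disconnected, and by `IsSpread.monopolarOn_or` otherwise. Since $\overline E$ is itself not
monopolar, it is all of $X$. -/

namespace SimpleGraph

variable {V W : Type*}

/-! ### Polar, monopolar and split covers of vertex sets -/

/-- The set `A` induces a complete multipartite graph. -/
def IsMultipartiteOn (G : SimpleGraph V) (A : Set V) : Prop :=
  ∀ x ∈ A, ∀ y ∈ A, ∀ z ∈ A, ¬ G.Adj x y → ¬ G.Adj y z → ¬ G.Adj x z

/-- The set `B` induces a cluster. -/
def IsClusterOn (G : SimpleGraph V) (B : Set V) : Prop :=
  ∀ x ∈ B, ∀ y ∈ B, ∀ z ∈ B, G.Adj x y → G.Adj y z → x ≠ z → G.Adj x z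

/-- The set `S` is covered by a complete multipartite graph and a cluster. -/
def PolarOn (G : SimpleGraph V) (S : Set V) : Prop :=
  ∃ A B : Set V, S ⊆ A ∪ B ∧ G.IsMultipartiteOn A ∧ G.IsClusterOn B

/-- The set `S` is covered by an independent set and a cluster. -/
def MonopolarOn (G : SimpleGraph V) (S : Set V) : Prop :=
  ∃ A B : Set V, S ⊆ A ∪ B ∧ G.IsIndepSet A ∧ G.IsClusterOn B

/-- The set `S` is covered by a clique and an independent set. -/
def SplitOn (G : SimpleGraph V) (S : Set V) : Prop :=
  ∃ A B : Set V, S ⊆ A ∪ B ∧ G.IsClique A ∧ G.IsIndepSet B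

/-- Every nontrivial vertex set sends an edge to its complement. -/
def NoCut (G : SimpleGraph V) : Prop :=
  ∀ S : Set V, S.Nonempty → Sᶜ.Nonempty → ∃ x ∈ S, ∃ y ∈ Sᶜ, G.Adj x y

theorem IsMultipartiteOn.mono {G : SimpleGraph V} {A B : Set V} (h : G.IsMultipartiteOn B)
    (hAB : A ⊆ B) : G.IsMultipartiteOn A :=
  fun x hx y hy z hz => h x (hAB hx) y (hAB hy) z (hAB hz)

theorem IsClusterOn.mono {G : SimpleGraph V} {A B : Set V} (h : G.IsClusterOn B)
    (hAB : A ⊆ B) : G.IsClusterOn A :=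
  fun x hx y hy z hz => h x (hAB hx) y (hAB hy) z (hAB hz)

theorem isMultipartiteOn_compl {G : SimpleGraph V} {A : Set V} :
    Gᶜ.IsMultipartiteOn A ↔ G.IsClusterOn A := by
  constructor
  · intro h x hx y hy z hz h1 h2 h3
    have := h x hx y hy z hz
    simp only [compl_adj] at this
    grind
  · intro h x hx y hy z hz
    have := h x hx y hy z hz
    simp only [compl_adj]
    grind

theorem isClusterOn_compl {G : SimpleGraph V} {A : Set V} :
    Gᶜ.IsClusterOn A ↔ G.IsMultipartiteOn A := by
  rw [← isMultipartiteOn_compl, compl_compl]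

theorem PolarOn.compl {G : SimpleGraph V} {S : Set V} (h : G.PolarOn S) : Gᶜ.PolarOn S := by
  obtain ⟨A, B, h, hA, hB⟩ := h
  exact ⟨B, A, by rwa [Set.union_comm], isMultipartiteOn_compl.2 hB, isClusterOn_compl.2 hA⟩

theorem SplitOn.compl {G : SimpleGraph V} {S : Set V} (h : G.SplitOn S) : Gᶜ.SplitOn S := by
  obtain ⟨A, B, h, hA, hB⟩ := h
  exact ⟨B, A, by rwa [Set.union_comm], by simpa using hB, by simpa using hA⟩

theorem IsIndepSet.isMultipartiteOn {G : SimpleGraph V} {A : Set V} (h : G.IsIndepSet A) :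
    G.IsMultipartiteOn A :=
  fun _ hx _ _ _ hz _ _ h3 => h hx hz h3.ne h3

theorem IsClique.isClusterOn {G : SimpleGraph V} {A : Set V} (h : G.IsClique A) :
    G.IsClusterOn A :=
  fun _ hx _ _ _ hz _ _ h3 => h hx hz h3

theorem MonopolarOn.polarOn {G : SimpleGraph V} {S : Set V} (h : G.MonopolarOn S) :
    G.PolarOn S := by
  obtain ⟨A, B, h, hA, hB⟩ := h
  exact ⟨A, B, h, hA.isMultipartiteOn, hB⟩

/-- A cover is as good as a partition, because both classes are closed under subsets and overlaps
can be discarded. -/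
theorem isPolar_induce_iff {G : SimpleGraph V} {S : Set V} :
    IsPolar (G.induce S) ↔ G.PolarOn S := by
  constructor
  · rintro ⟨A, B, -, hu, hA, hB⟩
    refine ⟨Subtype.val '' A, Subtype.val '' B, ?_, ?_, ?_⟩
    · intro x hx
      have : (⟨x, hx⟩ : S) ∈ A ∪ B := hu ▸ Set.mem_univ _
      rcases this with h | h
      · exact Or.inl ⟨_, h, rfl⟩
      · exact Or.inr ⟨_, h, rfl⟩
    · rintro _ ⟨x, hx, rfl⟩ _ ⟨y, hy, rfl⟩ _ ⟨z, hz, rfl⟩ h1 h2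
      exact hA.trans (a := ⟨x, hx⟩) (b := ⟨y, hy⟩) (c := ⟨z, hz⟩) h1 h2
    · rintro _ ⟨x, hx, rfl⟩ _ ⟨y, hy, rfl⟩ _ ⟨z, hz, rfl⟩ h1 h2 h3
      have := hB.trans (a := ⟨x, hx⟩) (b := ⟨y, hy⟩) (c := ⟨z, hz⟩) (by simp [h1])
        (by simp [h2])
      simp only [compl_adj, not_and, not_not, comap_adj] at this
      exact this (fun h => h3 (by simpa [Subtype.ext_iff] using h))
  · rintro ⟨A, B, hu, hA, hB⟩
    refine ⟨{x | x.1 ∈ A}, {x | x.1 ∉ A}, ?_, ?_, ?_, ?_⟩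
    · exact Set.disjoint_left.2 fun x h1 h2 => h2 h1
    · ext x; simp [em]
    · refine ⟨fun x y z h1 h2 => ?_⟩
      exact hA _ x.2 _ y.2 _ z.2 h1 h2
    · have hB' : ∀ x : {x : S | x.1 ∉ A}, x.1.1 ∈ B := fun x => (hu x.1.2).resolve_left x.2
      refine ⟨fun x y z h1 h2 => ?_⟩
      have := hB _ (hB' x) _ (hB' y) _ (hB' z)
      simp only [compl_adj, comap_adj, Function.Embedding.subtype_apply] at *
      grind

theorem isPolar_iff {G : SimpleGraph V} : IsPolar G ↔ G.PolarOn Set.univ := by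
  constructor
  · rintro ⟨A, B, -, hu, hA, hB⟩
    refine ⟨A, B, hu.ge, ?_, ?_⟩
    · intro x hx y hy z hz h1 h2
      exact hA.trans (a := ⟨x, hx⟩) (b := ⟨y, hy⟩) (c := ⟨z, hz⟩) h1 h2
    · intro x hx y hy z hz h1 h2 h3
      have := hB.trans (a := ⟨x, hx⟩) (b := ⟨y, hy⟩) (c := ⟨z, hz⟩) (by simp [h1])
        (by simp [h2])
      simp only [compl_adj, not_and, not_not, comap_adj] at this
      exact this (fun h => h3 (by simpa [Subtype.ext_iff] using h))
  · rintro ⟨A, B, hu, hA, hB⟩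
    refine ⟨A, Aᶜ, disjoint_compl_right, Set.union_compl_self A, ?_, ?_⟩
    · refine ⟨fun x y z h1 h2 => ?_⟩
      exact hA _ x.2 _ y.2 _ z.2 h1 h2
    · have hB' : ∀ x : (Aᶜ : Set V), x.1 ∈ B := fun x => (hu (Set.mem_univ x.1)).resolve_left x.2
      refine ⟨fun x y z h1 h2 => ?_⟩
      have := hB _ (hB' x) _ (hB' y) _ (hB' z)
      simp only [compl_adj, comap_adj, Function.Embedding.subtype_apply] at *
      grind

/-! ### Split graphs -/

/-- There is no induced `2K₂`. -/
def NoTwoEdges (G : SimpleGraph V) (S : Set V) : Prop :=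
  ∀ a ∈ S, ∀ b ∈ S, ∀ c ∈ S, ∀ d ∈ S, G.Adj a b → G.Adj c d → ¬ G.Adj a c → ¬ G.Adj a d →
    ¬ G.Adj b c → ¬ G.Adj b d → False

/-- There is no induced `C₄`. -/
def NoFourCycle (G : SimpleGraph V) (S : Set V) : Prop :=
  ∀ a ∈ S, ∀ b ∈ S, ∀ c ∈ S, ∀ d ∈ S, G.Adj a b → G.Adj b c → G.Adj c d → G.Adj d a → a ≠ c →
    b ≠ d → ¬ G.Adj a c → ¬ G.Adj b d → False

/-- There is no induced `C₅`. -/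
def NoFiveCycle (G : SimpleGraph V) (S : Set V) : Prop :=
  ∀ a ∈ S, ∀ b ∈ S, ∀ c ∈ S, ∀ d ∈ S, ∀ e ∈ S, G.Adj a b → G.Adj b c → G.Adj c d → G.Adj d e →
    G.Adj e a → ¬ G.Adj a c → ¬ G.Adj b d → ¬ G.Adj c e → ¬ G.Adj d a → ¬ G.Adj e b → False

theorem NoTwoEdges.compl {G : SimpleGraph V} {S : Set V} (h : G.NoTwoEdges S) :
    Gᶜ.NoFourCycle S := by
  intro a ha b hb c hc d hd h1 h2 h3 h4 h5 h6 h7 h8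
  simp only [compl_adj] at *
  exact h a ha c hc b hb d hd (by tauto) (by tauto) h1.2 (by rw [adj_comm]; exact h4.2)
    (by rw [adj_comm]; exact h2.2) h3.2

theorem NoFourCycle.compl {G : SimpleGraph V} {S : Set V} (h : G.NoFourCycle S) :
    Gᶜ.NoTwoEdges S := by
  intro a ha b hb c hc d hd h1 h2 h3 h4 h5 h6
  simp only [compl_adj] at *
  have := h a ha c hc b hb d hd
  grind [G.adj_comm]

/-- The partition is repaired by exchanging `v`, `k` and at most one vertex of `B`. Without induced
$C_4$, `v` and `k` have at most one common neighbour in `B`, and such a neighbour sees all of `A`,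
so it can move into the clique. -/
theorem splitOn_insert_of_unique {G : SimpleGraph V} {S A B : Set V} {v k : V} (hv : v ∈ S)
    (h2 : G.NoTwoEdges S) (h4 : G.NoFourCycle S) (hA : G.IsClique A) (hB : G.IsIndepSet B)
    (hAS : A ⊆ S) (hBS : B ⊆ S) (hk : k ∈ A) (hvk : ¬ G.Adj v k) (hkv : k ≠ v)
    (hA1 : ∀ x ∈ A, x ≠ k → G.Adj v x) : G.SplitOn (insert v (A ∪ B)) := by
  have hc4 : ∀ i ∈ B, ∀ j ∈ B, G.Adj v i → G.Adj v j → G.Adj k i → G.Adj k j → i = j := by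
    intro i hi j hj h1 h3 h5 h6
    by_contra hij
    exact h4 v hv i (hBS hi) k (hAS hk) j (hBS hj) h1 h5.symm h6 h3.symm hkv.symm hij hvk
      (hB hi hj hij)
  have hc4' : ∀ i ∈ B, G.Adj v i → G.Adj k i → ∀ x ∈ A, x ≠ i → G.Adj i x := by
    intro i hi h1 h3 x hx hxi
    by_contra hix
    have hxk : x ≠ k := by rintro rfl; exact hix h3.symm
    exact h4 v hv i (hBS hi) k (hAS hk) x (hAS hx) h1 h3.symm (hA hk hx hxk.symm)
      (hA1 x hx hxk).symm hkv.symm hxi.symm hvk hix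
  simp only [IsClique, IsIndepSet, Set.Pairwise] at hA hB
  by_cases c1 : ∀ x ∈ B, ¬ G.Adj k x
  · refine ⟨insert v (A \ {k}), insert k B, ?_, ?_, ?_⟩
    · intro x
      simp only [Set.mem_insert_iff, Set.mem_union, Set.mem_sdiff, Set.mem_singleton_iff]
      tauto
    · intro x hx y hy hxy
      simp only [Set.mem_insert_iff, Set.mem_sdiff, Set.mem_singleton_iff] at hx hy
      grind [G.adj_comm]
    · intro x hx y hy hxy
      simp only [Set.mem_insert_iff] at hx hy
      grind [G.adj_comm]
  push Not at c1
  obtain ⟨i, hi, hki⟩ := c1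
  by_cases c2 : ∀ j ∈ B, G.Adj v j → G.Adj k j
  · by_cases c3 : ∃ j ∈ B, G.Adj v j
    · obtain ⟨j, hj, hvj⟩ := c3
      have hkj := c2 j hj hvj
      have hj2 := hc4' j hj hvj hkj
      refine ⟨insert j A, insert v (B \ {j}), ?_, ?_, ?_⟩
      · intro x
        simp only [Set.mem_insert_iff, Set.mem_union, Set.mem_sdiff, Set.mem_singleton_iff]
        tauto
      · intro x hx y hy hxy
        simp only [Set.mem_insert_iff] at hx hy
        grind [G.adj_comm]
      · intro x hx y hy hxy
        simp only [Set.mem_insert_iff, Set.mem_sdiff, Set.mem_singleton_iff] at hx hy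
        grind [G.adj_comm]
    · push Not at c3
      refine ⟨A, insert v B, ?_, hA, ?_⟩
      · intro x
        simp only [Set.mem_insert_iff, Set.mem_union]
        tauto
      · intro x hx y hy hxy
        simp only [Set.mem_insert_iff] at hx hy
        grind [G.adj_comm]
  push Not at c2
  obtain ⟨j, hj, hvj, hkj⟩ := c2
  -- Otherwise `vj` and `ki` form a $2K_2$. Hence `i` is the only neighbour of `k` in `B`, and `k`
  -- can trade places with `i` and `v`.
  have hv1 : ∀ i ∈ B, G.Adj k i → G.Adj v i := by
    intro i hi hki
    by_contra hvi
    exact h2 v hv j (hBS hj) k (hAS hk) i (hBS hi) hvj hki hvk hvi (fun h => hkj h.symm)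
      (hB hj hi (by rintro rfl; exact hkj hki))
  have hi1 := hv1 i hi hki
  have hi2 := hc4' i hi hi1 hki
  refine ⟨insert v (insert i (A \ {k})), insert k (B \ {i}), ?_, ?_, ?_⟩
  · intro x
    simp only [Set.mem_insert_iff, Set.mem_union, Set.mem_sdiff, Set.mem_singleton_iff]
    tauto
  · intro x hx y hy hxy
    simp only [Set.mem_insert_iff, Set.mem_sdiff, Set.mem_singleton_iff] at hx hy
    grind [G.adj_comm]
  · intro x hx y hy hxy
    simp only [Set.mem_insert_iff, Set.mem_sdiff, Set.mem_singleton_iff] at hx hy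
    grind [G.adj_comm]

/-- A finite set without induced `2K₂`, `C₄`, `C₅` is split. -/
theorem splitOn_of_finite {G : SimpleGraph V} {S : Set V} (hS : S.Finite) (h2 : G.NoTwoEdges S)
    (h4 : G.NoFourCycle S) (h5 : G.NoFiveCycle S) : G.SplitOn S := by
  suffices h : ∀ T ⊆ S, G.SplitOn T from h S subset_rfl
  intro T hT
  induction T, hS.subset hT using Set.Finite.induction_on with
  | empty => exact ⟨∅, ∅, by simp, by simp, by simp [IsIndepSet]⟩
  | @insert v T hvT _ ih =>
    obtain ⟨A', B', hu, hA', hB'⟩ := ih ((Set.subset_insert _ _).trans hT)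
    have hvS : v ∈ S := hT (Set.mem_insert _ _)
    have hTS : T ⊆ S := (Set.subset_insert _ _).trans hT
    -- The cover may spill outside `T` and even contain `v`, so it is trimmed.
    obtain ⟨A, hAd⟩ : ∃ A, A = A' ∩ T := ⟨_, rfl⟩
    obtain ⟨B, hBd⟩ : ∃ B, B = B' ∩ T := ⟨_, rfl⟩
    have hA : G.IsClique A := hA'.subset (by rw [hAd]; exact Set.inter_subset_left)
    have hB : G.IsIndepSet B := hB'.mono (by rw [hBd]; exact Set.inter_subset_left)
    have hAT : A ⊆ T := by rw [hAd]; exact Set.inter_subset_right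
    have hBT : B ⊆ T := by rw [hBd]; exact Set.inter_subset_right
    have hAv : ∀ x ∈ A, x ≠ v := fun x hx h => hvT (h ▸ hAT hx)
    have hBv : ∀ x ∈ B, x ≠ v := fun x hx h => hvT (h ▸ hBT hx)
    have hTAB : T = A ∪ B := by
      rw [hAd, hBd, ← Set.union_inter_distrib_right]
      exact (Set.inter_eq_right.2 hu).symm
    rw [hTAB]
    by_cases c1 : ∃ k ∈ A, ¬ G.Adj v k
    swap
    · push Not at c1
      refine ⟨insert v A, B, by rw [Set.insert_union], ?_, hB⟩
      exact hA.insert fun x hx _ => c1 x hx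
    by_cases c2 : ∃ i ∈ B, G.Adj v i
    swap
    · push Not at c2
      refine ⟨A, insert v B, by rw [Set.union_insert], hA, ?_⟩
      exact Set.Pairwise.insert hB fun x hx _ => ⟨c2 x hx, fun h => c2 x hx h.symm⟩
    obtain ⟨k, hk, hvk⟩ := c1
    obtain ⟨i, hi, hvi⟩ := c2
    by_cases c3 : ∃ l ∈ A, l ≠ k ∧ ¬ G.Adj v l
    swap
    · push Not at c3
      exact splitOn_insert_of_unique hvS h2 h4 hA hB (hAT.trans hTS) (hBT.trans hTS) hk hvk
        (hAv k hk) c3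
    by_cases c4 : ∃ j ∈ B, j ≠ i ∧ G.Adj v j
    swap
    · push Not at c4
      -- Complementation exchanges clique and independent set, as well as $2K_2$ and $C_4$, so a
      -- unique neighbour in `B` is dual to a unique non-neighbour in `A`.
      rw [Set.union_comm, ← compl_compl G]
      refine (splitOn_insert_of_unique (G := Gᶜ) hvS h4.compl h2.compl (by simpa using hB)
        (by simpa using hA) (hBT.trans hTS) (hAT.trans hTS) hi (by simp [hvi]) (hBv i hi)
        fun x hx hxi => ?_).compl
      exact ⟨(hBv x hx).symm, c4 x hx hxi⟩
    obtain ⟨l, hl, hlk, hvl⟩ := c3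
    obtain ⟨j, hj, hji, hvj⟩ := c4
    have hkl := hA hk hl hlk.symm
    have hij := hB hi hj hji.symm
    -- Each of `i`, `j` sees `k` or `l`, by absence of $2K_2$. A shared neighbour among `k`, `l`
    -- closes a $C_4$ through `v`; distinct ones close a $C_5$.
    have m1 := h2 v hvS i (hTS (hBT hi)) k (hTS (hAT hk)) l (hTS (hAT hl)) hvi hkl hvk hvl
    have m2 := h2 v hvS j (hTS (hBT hj)) k (hTS (hAT hk)) l (hTS (hAT hl)) hvj hkl hvk hvl
    have m3 := h4 v hvS i (hTS (hBT hi)) k (hTS (hAT hk)) j (hTS (hBT hj)) hvi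
    have m4 := h4 v hvS i (hTS (hBT hi)) l (hTS (hAT hl)) j (hTS (hBT hj)) hvi
    have m5 := h5 v hvS i (hTS (hBT hi)) k (hTS (hAT hk)) l (hTS (hAT hl)) j (hTS (hBT hj)) hvi
    have m6 := h5 v hvS i (hTS (hBT hi)) l (hTS (hAT hl)) k (hTS (hAT hk)) j (hTS (hBT hj)) hvi
    have := hAv k hk
    have := hAv l hl
    grind [G.adj_comm]

/-! ### Essential graphs as induced subgraphs -/

/-- Some essential graph is an induced subgraph of `G`. -/
def ContainsEssential (G : SimpleGraph V) : Prop :=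
  ∃ (W : Type) (F : SimpleGraph W), IsEssentialGraph F ∧ Nonempty (F ↪g G)

theorem nonempty_embedding {F : SimpleGraph W} {G : SimpleGraph V} (f : W → V)
    (h : ∀ x y, (x ≠ y → f x ≠ f y) ∧ (G.Adj (f x) (f y) ↔ F.Adj x y)) : Nonempty (F ↪g G) :=
  ⟨⟨⟨f, fun x y hxy => by_contra fun hne => (h x y).1 hne hxy⟩, (h _ _).2⟩⟩

theorem containsEssential_of_two_edges {G : SimpleGraph V} {i a b c d : V}
    (hi : ¬ G.Adj i a ∧ ¬ G.Adj i b ∧ ¬ G.Adj i c ∧ ¬ G.Adj i d)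
    (h1 : G.Adj a b) (h2 : G.Adj c d)
    (h3 : ¬ G.Adj a c) (h4 : ¬ G.Adj a d) (h5 : ¬ G.Adj b c) (h6 : ¬ G.Adj b d) :
    G.ContainsEssential := by
  refine ⟨_, _, Or.inl ⟨Iso.refl⟩, nonempty_embedding (Sum.elim ![i] (Sum.elim ![a, b] ![c, d])) ?_⟩
  have := h1.ne
  have := h2.ne
  rintro (x | x | x) (y | y | y) <;> fin_cases x <;> fin_cases y <;> simp <;> grind [G.adj_comm]

theorem containsEssential_of_two_paths {G : SimpleGraph V} {a b c d e f : V}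
    (h1 : G.Adj a b) (h2 : G.Adj b c) (h3 : ¬ G.Adj a c) (hac : a ≠ c)
    (h4 : G.Adj d e) (h5 : G.Adj e f) (h6 : ¬ G.Adj d f) (hdf : d ≠ f)
    (h : ∀ x ∈ ({a, b, c} : Set V), ∀ y ∈ ({d, e, f} : Set V), ¬ G.Adj x y) :
    G.ContainsEssential := by
  refine ⟨_, _, Or.inr (Or.inl ⟨Iso.refl⟩), nonempty_embedding (Sum.elim ![a, b, c] ![d, e, f]) ?_⟩
  have := h1.ne
  have := h2.ne
  have := h4.ne
  have := h5.ne
  simp only [Set.mem_insert_iff, Set.mem_singleton_iff, forall_eq_or_imp, forall_eq] at h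
  rintro (x | x) (y | y) <;> fin_cases x <;> fin_cases y <;> simp [pathGraph_adj] <;> grind [G.adj_comm]

/-- The vertices `a, b, c, d` form an induced four-cycle. -/
def IsC4 (G : SimpleGraph V) (a b c d : V) : Prop :=
  G.Adj a b ∧ G.Adj b c ∧ G.Adj c d ∧ G.Adj d a ∧ a ≠ c ∧ b ≠ d ∧ ¬ G.Adj a c ∧ ¬ G.Adj b d

theorem IsC4.rotate {G : SimpleGraph V} {a b c d : V} (h : G.IsC4 a b c d) : G.IsC4 b c d a := by
  unfold IsC4 at *
  grind [G.adj_comm]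

theorem containsEssential_of_isC4_of_two_isolated {G : SimpleGraph V} {a b c d i j : V} (hC : G.IsC4 a b c d)
    (hij : i ≠ j) (h : ¬ G.Adj i j)
    (hi : ¬ G.Adj i a ∧ ¬ G.Adj i b ∧ ¬ G.Adj i c ∧ ¬ G.Adj i d)
    (hj : ¬ G.Adj j a ∧ ¬ G.Adj j b ∧ ¬ G.Adj j c ∧ ¬ G.Adj j d) :
    G.ContainsEssential := by
  refine ⟨_, _, Or.inr (Or.inr (Or.inl ⟨Iso.refl⟩)),
    nonempty_embedding (Sum.elim ![a, b, c, d] (Sum.elim ![i] ![j])) ?_⟩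
  obtain ⟨h1, h2, h3, h4, h5, h6, h7, h8⟩ := hC
  have := h1.ne
  have := h2.ne
  have := h3.ne
  have := h4.ne
  rintro (x | x | x) (y | y | y) <;> fin_cases x <;> fin_cases y <;>
    simp [cycleGraph_adj'] <;> grind [G.adj_comm]

theorem containsEssential_of_isC4_of_adj_three {G : SimpleGraph V} {a b c d v i : V} (hC : G.IsC4 a b c d)
    (hi : ¬ G.Adj i a ∧ ¬ G.Adj i b ∧ ¬ G.Adj i c ∧ ¬ G.Adj i d ∧ ¬ G.Adj i v)
    (ha : G.Adj v a) (hb : G.Adj v b) (hc : G.Adj v c) (hd : ¬ G.Adj v d) :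
    G.ContainsEssential := by
  -- In the complement the four-cycle becomes the edges `ac` and `bd`, and the non-edge `vd` extends
  -- the latter to the path `v, d, b`.
  refine ⟨_, _, Or.inr (Or.inr (Or.inr (Or.inl ⟨Iso.refl⟩))),
    nonempty_embedding (Sum.elim ![i] (Sum.elim ![v, d, b] ![a, c])) ?_⟩
  have := hb.ne
  obtain ⟨h1, h2, h3, h4, h5, h6, h7, h8⟩ := hC
  have := h1.ne
  have := h2.ne
  have := h3.ne
  have := h4.ne
  rintro (x | x | x) (y | y | y) <;> fin_cases x <;> fin_cases y <;>
    simp [pathGraph_adj] <;> grind [G.adj_comm]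

theorem containsEssential_of_isolated_of_C5 {G : SimpleGraph V} {a b c d e i : V}
    (hi : ¬ G.Adj i a ∧ ¬ G.Adj i b ∧ ¬ G.Adj i c ∧ ¬ G.Adj i d ∧ ¬ G.Adj i e)
    (h1 : G.Adj a b) (h2 : G.Adj b c) (h3 : G.Adj c d) (h4 : G.Adj d e) (h5 : G.Adj e a)
    (g1 : ¬ G.Adj a c) (g2 : ¬ G.Adj b d) (g3 : ¬ G.Adj c e) (g4 : ¬ G.Adj d a)
    (g5 : ¬ G.Adj e b) : G.ContainsEssential := by
  refine ⟨_, _, Or.inr (Or.inr (Or.inr (Or.inr (Or.inl ⟨Iso.refl⟩)))),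
    nonempty_embedding (Sum.elim ![i] ![a, b, c, d, e]) ?_⟩
  rintro (x | x) (y | y) <;> fin_cases x <;> fin_cases y <;>
    simp [cycleGraph_adj'] <;> grind [G.adj_comm]

theorem containsEssential_of_isC4_of_adj_one {G : SimpleGraph V} {a b c d v i : V} (hC : G.IsC4 a b c d)
    (hi : ¬ G.Adj i a ∧ ¬ G.Adj i b ∧ ¬ G.Adj i c ∧ ¬ G.Adj i d ∧ ¬ G.Adj i v)
    (ha : G.Adj v a) (hb : ¬ G.Adj v b) (hc : ¬ G.Adj v c) (hd : ¬ G.Adj v d) :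
    G.ContainsEssential := by
  refine ⟨_, _, Or.inr (Or.inr (Or.inr (Or.inr (Or.inr (Or.inl ⟨Iso.refl⟩))))),
    nonempty_embedding (Sum.elim ![i] ![a, b, c, d, v]) ?_⟩
  obtain ⟨h1, h2, h3, h4, h5, h6, h7, h8⟩ := hC
  have := h1.ne
  have := h2.ne
  have := h3.ne
  have := h4.ne
  rintro (x | x) (y | y) <;> fin_cases x <;> fin_cases y <;>
    simp [bannerGraph] <;> grind [G.adj_comm]

theorem containsEssential_of_isC4_of_adj_two {G : SimpleGraph V} {a b c d v i : V} (hC : G.IsC4 a b c d)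
    (hi : ¬ G.Adj i a ∧ ¬ G.Adj i b ∧ ¬ G.Adj i c ∧ ¬ G.Adj i d ∧ ¬ G.Adj i v)
    (ha : G.Adj v a) (hb : G.Adj v b) (hc : ¬ G.Adj v c) (hd : ¬ G.Adj v d) :
    G.ContainsEssential := by
  -- The non-edges form the path `b, d, v, c, a`.
  refine ⟨_, _, Or.inr (Or.inr (Or.inr (Or.inr (Or.inr (Or.inr ⟨Iso.refl⟩))))),
    nonempty_embedding (Sum.elim ![i] ![b, d, v, c, a]) ?_⟩
  obtain ⟨h1, h2, h3, h4, h5, h6, h7, h8⟩ := hC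
  have := h1.ne
  have := h2.ne
  have := h3.ne
  have := h4.ne
  rintro (x | x) (y | y) <;> fin_cases x <;> fin_cases y <;>
    simp [pathGraph_adj] <;> grind [G.adj_comm]

/-- Two vertices of one part and one of another induce a $P_3$, which a cluster excludes. Once there
is an edge, all parts are therefore singletons. -/
theorem IsMultipartiteOn.isClique {G : SimpleGraph V} {A : Set V} (hA : G.IsMultipartiteOn A)
    (hA' : G.IsClusterOn A) {u v : V} (hu : u ∈ A) (hv : v ∈ A) (huv : G.Adj u v) :
    G.IsClique A := by
  intro x hx y hy hxy
  by_contra h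
  have h1 := hA x hx u hu v hv
  have h2 := hA y hy u hu v hv
  have h3 := hA' x hx u hu y hy
  have h4 := hA' x hx v hv y hy
  have h5 := hA x hx y hy u hu
  have h6 := hA x hx y hy v hv
  have h7 := hA y hy x hx u hu
  have h8 := hA y hy x hx v hv
  have h9 := hA u hu x hx v hv
  grind [G.adj_comm]

/-- Together with the isolated vertex `i`, seeing none, one, two consecutive or three cycle vertices
yields an essential graph. Only an opposite pair or the whole cycle remains. -/
theorem IsC4.adj_iff_adj {G : SimpleGraph V} (hn : ¬ G.ContainsEssential) {i : V}
    (hi : ∀ v, ¬ G.Adj i v) {a b c d v : V} (hC : G.IsC4 a b c d) (hv : v ≠ i) :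
    (G.Adj v a ↔ G.Adj v c) ∧ (G.Adj v b ↔ G.Adj v d) ∧ (G.Adj v a ∨ G.Adj v b) := by
  have h3 : ¬ G.Adj v a → ¬ G.Adj v b → ¬ G.Adj v c → ¬ G.Adj v d → False := fun h1 h2 h3 h4 =>
    hn (containsEssential_of_isC4_of_two_isolated hC hv.symm (hi v) ⟨hi a, hi b, hi c, hi d⟩ ⟨h1, h2, h3, h4⟩)
  have h4 : ∀ a b c d, G.IsC4 a b c d → G.Adj v a → G.Adj v b → G.Adj v c →
      ¬ G.Adj v d → False := fun a b c d hC h1 h2 h3 h4 =>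
    hn (containsEssential_of_isC4_of_adj_three hC ⟨hi a, hi b, hi c, hi d, hi v⟩ h1 h2 h3 h4)
  have h6 : ∀ a b c d, G.IsC4 a b c d → G.Adj v a → ¬ G.Adj v b → ¬ G.Adj v c →
      ¬ G.Adj v d → False := fun a b c d hC h1 h2 h3 h4 =>
    hn (containsEssential_of_isC4_of_adj_one hC ⟨hi a, hi b, hi c, hi d, hi v⟩ h1 h2 h3 h4)
  have h7 : ∀ a b c d, G.IsC4 a b c d → G.Adj v a → G.Adj v b → ¬ G.Adj v c →
      ¬ G.Adj v d → False := fun a b c d hC h1 h2 h3 h4 =>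
    hn (containsEssential_of_isC4_of_adj_two hC ⟨hi a, hi b, hi c, hi d, hi v⟩ h1 h2 h3 h4)
  have r1 := hC.rotate
  have r2 := r1.rotate
  have r3 := r2.rotate
  by_cases pa : G.Adj v a <;> by_cases pb : G.Adj v b <;> by_cases pc : G.Adj v c <;>
    by_cases pd : G.Adj v d
  · exact ⟨iff_of_true pa pc, iff_of_true pb pd, Or.inl pa⟩
  · exact (h4 _ _ _ _ hC pa pb pc pd).elim
  · exact (h4 _ _ _ _ r3 pd pa pb pc).elim
  · exact (h7 _ _ _ _ hC pa pb pc pd).elim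
  · exact (h4 _ _ _ _ r2 pc pd pa pb).elim
  · exact ⟨iff_of_true pa pc, iff_of_false pb pd, Or.inl pa⟩
  · exact (h7 _ _ _ _ r3 pd pa pb pc).elim
  · exact (h6 _ _ _ _ hC pa pb pc pd).elim
  · exact (h4 _ _ _ _ r1 pb pc pd pa).elim
  · exact (h7 _ _ _ _ r1 pb pc pd pa).elim
  · exact ⟨iff_of_false pa pc, iff_of_true pb pd, Or.inr pb⟩
  · exact (h6 _ _ _ _ r1 pb pc pd pa).elim
  · exact (h7 _ _ _ _ r2 pc pd pa pb).elim
  · exact (h6 _ _ _ _ r2 pc pd pa pb).elim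
  · exact (h6 _ _ _ _ r3 pd pa pb pc).elim
  · exact (h3 pa pb pc pd).elim

/-- The cycle determines the parts: a vertex missing `b` can replace `d` in the cycle and so becomes
a twin of `b`; likewise for `a`. Two nonadjacent vertices that see the whole cycle form a new $C_4$
with `a` and `c`, so they are twins too. -/
theorem isMultipartiteOn_of_isC4 {G : SimpleGraph V} {S : Set V} {a b c d : V} (hC : G.IsC4 a b c d)
    (hD : ∀ a b c d, G.IsC4 a b c d → ∀ v ∈ S,
      (G.Adj v a ↔ G.Adj v c) ∧ (G.Adj v b ↔ G.Adj v d) ∧ (G.Adj v a ∨ G.Adj v b)) :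
    G.IsMultipartiteOn S := by
  have hT : ∀ a b c d, G.IsC4 a b c d → ∀ v ∈ S, ¬ G.Adj v b → ∀ w ∈ S,
      (G.Adj v w ↔ G.Adj w b) := by
    intro a b c d hC v hv h2 w hw
    obtain ⟨h3, h4, h5⟩ := hD a b c d hC v hv
    rw [G.adj_comm v w]
    by_cases hvb : v = b
    · rw [hvb]
    have h1 : G.Adj v a := h5.resolve_right h2
    have h6 : G.IsC4 a b c v := ⟨hC.1, hC.2.1, (h3.1 h1).symm, h1, hC.2.2.2.2.1, Ne.symm hvb,
      hC.2.2.2.2.2.2.1, fun h => h2 h.symm⟩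
    exact (hD a b c v h6 w hw).2.1.symm
  intro x hx y hy z hz h1 h2 h3
  by_cases yb : G.Adj y b
  · by_cases ya : G.Adj y a
    · have xb : G.Adj x b := by
        by_contra h
        exact h1 ((hT a b c d hC x hx h y hy).2 yb)
      have xa : G.Adj x a := by
        by_contra h
        exact h1 ((hT d a b c hC.rotate.rotate.rotate x hx h y hy).2 ya)
      have hxy : G.IsC4 x a y c := ⟨xa, ya.symm, (hD a b c d hC y hy).1.1 ya,
        ((hD a b c d hC x hx).1.1 xa).symm, by rintro rfl; exact h2 h3, hC.2.2.2.2.1, h1,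
        hC.2.2.2.2.2.2.1⟩
      exact h2 ((hD x a y c hxy z hz).1.1 h3.symm).symm
    · have key := hT d a b c hC.rotate.rotate.rotate
      have xa : ¬ G.Adj x a := fun h => h1 ((key y hy ya x hx).2 h).symm
      have za : ¬ G.Adj z a := fun h => h2 ((key y hy ya z hz).2 h)
      exact za ((key x hx xa z hz).1 h3)
  · have key := hT a b c d hC
    have xb : ¬ G.Adj x b := fun h => h1 ((key y hy yb x hx).2 h).symm
    have zb : ¬ G.Adj z b := fun h => h2 ((key y hy yb z hz).2 h)
    exact zb ((key x hx xb z hz).1 h3)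

/-! ### Essential graphs in disconnected graphs -/

/-- A finite disconnected graph that is not covered by a clique and a complete multipartite
graph contains one of the seven essential graphs. -/
theorem containsEssential_of_cut [Finite V] {G : SimpleGraph V} {Y : Set V} (hY : Y.Nonempty)
    (hY' : Yᶜ.Nonempty) (hcut : ∀ x ∈ Y, ∀ y ∈ Yᶜ, ¬ G.Adj x y)
    (hG : ¬ Gᶜ.MonopolarOn Set.univ) : G.ContainsEssential := by
  classical
  have hQ : ∀ K M : Set V, Set.univ ⊆ K ∪ M → G.IsClique K → G.IsMultipartiteOn M → False :=
    fun K M h1 h2 h3 => hG ⟨K, M, h1, by simpa using h2, isClusterOn_compl.2 h3⟩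
  by_contra hn
  -- A set that is not complete multipartite contains $K_1+K_2$; an edge on the other side completes
  -- $K_1+2K_2$.
  have hA : ∀ Z : Set V, (∀ x ∈ Z, ∀ y ∈ Zᶜ, ¬ G.Adj x y) → ∀ p ∈ Zᶜ, ∀ q ∈ Zᶜ, G.Adj p q →
      G.IsMultipartiteOn Z := by
    intro Z hZ p hp q hq hpq x hx y hy z hz h1 h2 h3
    exact hn (containsEssential_of_two_edges ⟨fun h => h1 h.symm, h2, hZ y hy p hp, hZ y hy q hq⟩ h3 hpq
      (hZ x hx p hp) (hZ x hx q hq) (hZ z hz p hp) (hZ z hz q hq))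
  have hcut' : ∀ x ∈ Yᶜ, ∀ y ∈ Yᶜᶜ, ¬ G.Adj x y :=
    fun x hx y hy h => hcut y (by simpa using hy) x hx h.symm
  -- With edges on both sides, both are multipartite. If one is a cluster it is a clique, against
  -- `hQ`; otherwise each side has a $P_3$ and $2P_3$ appears.
  have hB : (∀ x ∈ Y, ∀ y ∈ Y, ¬ G.Adj x y) ∨ (∀ x ∈ Yᶜ, ∀ y ∈ Yᶜ, ¬ G.Adj x y) := by
    by_contra hB
    push Not at hB
    obtain ⟨⟨u, hu, w, hw, huw⟩, p, hp, q, hq, hpq⟩ := hB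
    have m1 := hA Y hcut p hp q hq hpq
    have m2 := hA Yᶜ hcut' u (by simpa using hu) w (by simpa using hw) huw
    by_cases c1 : G.IsClusterOn Y
    · exact hQ Y Yᶜ (by simp) (m1.isClique c1 hu hw huw) m2
    by_cases c2 : G.IsClusterOn Yᶜ
    · exact hQ Yᶜ Y (by simp) (m2.isClique c2 hp hq hpq) m1
    simp only [IsClusterOn] at c1 c2
    push Not at c1 c2
    obtain ⟨a, ha, b, hb, c, hc, h1, h2, h3, h4⟩ := c1
    obtain ⟨d, hd, e, he, f, hf, h5, h6, h7, h8⟩ := c2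
    refine hn (containsEssential_of_two_paths h1 h2 h4 h3 h5 h6 h8 h7 fun x hx y hy => hcut x ?_ y ?_)
    · rcases hx with rfl | rfl | rfl <;> assumption
    · rcases hy with rfl | rfl | rfl <;> assumption
  obtain ⟨i, hi⟩ : ∃ i, ∀ v, ¬ G.Adj i v := by
    rcases hB with h | h
    · obtain ⟨i, hi⟩ := hY
      exact ⟨i, fun v => if hv : v ∈ Y then h i hi v hv else hcut i hi v hv⟩
    · obtain ⟨i, hi⟩ := hY'
      exact ⟨i, fun v => if hv : v ∈ Yᶜ then h i hi v hv else hcut' i hi v hv⟩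
  -- The isolated vertex turns a $2K_2$ or $C_5$ into an essential graph, so without a $C_4$ the
  -- whole graph would be split.
  obtain ⟨a, b, c, d, hC⟩ : ∃ a b c d, G.IsC4 a b c d := by
    by_contra hC
    push Not at hC
    obtain ⟨A, B, hu, hA, hB⟩ := splitOn_of_finite (G := G) (S := Set.univ) Set.finite_univ
      (fun a _ b _ c _ d _ h1 h2 h3 h4 h5 h6 =>
        hn (containsEssential_of_two_edges ⟨hi a, hi b, hi c, hi d⟩ h1 h2 h3 h4 h5 h6))
      (fun a _ b _ c _ d _ h1 h2 h3 h4 h5 h6 h7 h8 => hC a b c d ⟨h1, h2, h3, h4, h5, h6, h7, h8⟩)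
      (fun a _ b _ c _ d _ e _ h1 h2 h3 h4 h5 g1 g2 g3 g4 g5 =>
        hn (containsEssential_of_isolated_of_C5 ⟨hi a, hi b, hi c, hi d, hi e⟩ h1 h2 h3 h4 h5 g1 g2 g3 g4 g5))
    exact hQ A B hu hA hB.isMultipartiteOn
  have hD : ∀ a b c d, G.IsC4 a b c d → ∀ v, v ≠ i →
      (G.Adj v a ↔ G.Adj v c) ∧ (G.Adj v b ↔ G.Adj v d) ∧ (G.Adj v a ∨ G.Adj v b) :=
    fun _ _ _ _ hC _ hv => hC.adj_iff_adj hn hi hv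
  exact hQ {i} {i}ᶜ (by simp) (by simp) (isMultipartiteOn_of_isC4 hC fun _ _ _ _ hC' _ hv => hD _ _ _ _ hC' _ hv)

/-! ### Complements of essential graphs are not monopolar -/

theorem not_monopolarOn_compl_of_bool {G : SimpleGraph V}
    (h : ¬ ∃ p : V → Bool, (∀ x y, p x → p y → x ≠ y → G.Adj x y) ∧
      ∀ x y z, p x = false → p y = false → p z = false → ¬ G.Adj x y → ¬ G.Adj y z → ¬ G.Adj x z) :
    ¬ Gᶜ.MonopolarOn Set.univ := by
  classical
  rintro ⟨A, B, hu, hA, hB⟩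
  refine h ⟨fun x => decide (x ∈ A), ?_, ?_⟩
  · intro x y hx hy hxy
    exact ((isIndepSet_compl _).1 hA) (by simpa using hx) (by simpa using hy) hxy
  · intro x y z hx hy hz
    have : ∀ x, decide (x ∈ A) = false → x ∈ B := fun x hx =>
      (hu (Set.mem_univ x)).resolve_left (by simpa using hx)
    exact isClusterOn_compl.1 hB x (this x hx) y (this y hy) z (this z hz)

theorem MonopolarOn.comap {G : SimpleGraph V} {F : SimpleGraph W} {S : Set V}
    (h : G.MonopolarOn S) (f : F ↪g G) : F.MonopolarOn (f ⁻¹' S) := by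
  obtain ⟨A, B, hu, hA, hB⟩ := h
  refine ⟨f ⁻¹' A, f ⁻¹' B, Set.preimage_mono hu, ?_, ?_⟩
  · intro x hx y hy hxy h
    exact hA hx hy (f.injective.ne hxy) (f.map_adj_iff.2 h)
  · intro x hx y hy z hz h1 h2 h3
    exact f.map_adj_iff.1 (hB _ hx _ hy _ hz (f.map_adj_iff.2 h1) (f.map_adj_iff.2 h2)
      (f.injective.ne h3))

theorem bannerGraph_adj_iff {x y : Fin 5} : bannerGraph.Adj x y ↔
    (x, y) ∈ [(0, 1), (1, 2), (2, 3), (3, 0), (0, 4), (1, 0), (2, 1), (3, 2), (0, 3), (4, 0)] := by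
  fin_cases x <;> fin_cases y <;> simp [bannerGraph]

instance : DecidableRel bannerGraph.Adj := fun _ _ => decidable_of_iff' _ bannerGraph_adj_iff

instance {G : SimpleGraph V} {F : SimpleGraph W} [DecidableRel G.Adj] [DecidableRel F.Adj] :
    DecidableRel (G ⊕g F).Adj
  | .inl a, .inl b => decidable_of_iff (G.Adj a b) (by simp)
  | .inr a, .inr b => decidable_of_iff (F.Adj a b) (by simp)
  | .inl a, .inr b => .isFalse (by simp)
  | .inr a, .inl b => .isFalse (by simp)

instance {n : ℕ} : DecidableRel (pathGraph n).Adj := fun _ _ => decidable_of_iff' _ pathGraph_adj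

/-- Essential graphs have at most six vertices, so evaluating all two-colourings settles each case.
-/
theorem not_monopolarOn_compl {F : SimpleGraph W} (hF : IsEssentialGraph F) :
    ¬ Fᶜ.MonopolarOn Set.univ := by
  have key : ∀ {U : Type} [Fintype U] [DecidableEq U] (G : SimpleGraph U) [DecidableRel G.Adj],
      decide (∃ p : U → Bool,
      (∀ x y, p x → p y → x ≠ y → G.Adj x y) ∧
      ∀ x y z, p x = false → p y = false → p z = false → ¬ G.Adj x y → ¬ G.Adj y z → ¬ G.Adj x z) = false →
      Nonempty (F ≃g G) → ¬ Fᶜ.MonopolarOn Set.univ := by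
    rintro U _ _ G _ h ⟨f⟩ hM
    exact not_monopolarOn_compl_of_bool (of_decide_eq_false h) (hM.comap (Embedding.complEquiv f.symm.toEmbedding))
  rcases hF with h | h | h | h | h | h | h <;> refine key _ ?_ h <;> rfl

/-! ### Induced paths on four vertices -/

/-- The vertices `a, b, c, d` form an induced path, in this order. -/
def IsP4 (G : SimpleGraph V) (a b c d : V) : Prop :=
  G.Adj a b ∧ G.Adj b c ∧ G.Adj c d ∧ ¬ G.Adj a c ∧ ¬ G.Adj a d ∧ ¬ G.Adj b d

/-- The set `W` induces a `P₄`. -/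
def IsP4Set (G : SimpleGraph V) (W : Set V) : Prop :=
  ∃ a b c d, G.IsP4 a b c d ∧ W = {a, b, c, d}

theorem IsP4.symm {G : SimpleGraph V} {a b c d : V} (h : G.IsP4 a b c d) : G.IsP4 d c b a := by
  unfold IsP4 at *
  grind [G.adj_comm]

theorem IsP4.ne {G : SimpleGraph V} {a b c d : V} (h : G.IsP4 a b c d) :
    a ≠ b ∧ a ≠ c ∧ a ≠ d ∧ b ≠ c ∧ b ≠ d ∧ c ≠ d := by
  have := h.1.ne
  have := h.2.1.ne
  have := h.2.2.1.ne
  unfold IsP4 at *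
  grind [G.adj_comm]

theorem IsP4.compl {G : SimpleGraph V} {a b c d : V} (h : G.IsP4 a b c d) : Gᶜ.IsP4 b d a c := by
  have := h.ne
  unfold IsP4 at *
  simp only [compl_adj]
  grind [G.adj_comm]

theorem IsP4Set.compl {G : SimpleGraph V} {W : Set V} (h : G.IsP4Set W) : Gᶜ.IsP4Set W := by
  obtain ⟨a, b, c, d, h, rfl⟩ := h
  refine ⟨b, d, a, c, h.compl, ?_⟩
  ext x
  simp only [Set.mem_insert_iff, Set.mem_singleton_iff]
  tauto

theorem IsP4Set.ncard_eq {G : SimpleGraph V} {W : Set V} (h : G.IsP4Set W) : W.ncard = 4 := by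
  obtain ⟨a, b, c, d, h, rfl⟩ := h
  obtain ⟨h1, h2, h3, h4, h5, h6⟩ := h.ne
  rw [Set.ncard_insert_of_notMem (by simp [h1, h2, h3]),
    Set.ncard_insert_of_notMem (by simp [h4, h5]), Set.ncard_pair h6]

theorem IsP4Set.finite {G : SimpleGraph V} {W : Set V} (h : G.IsP4Set W) : W.Finite := by
  obtain ⟨a, b, c, d, h, rfl⟩ := h
  exact Set.toFinite _

theorem IsP4Set.inducesP4 {G : SimpleGraph V} {W : Set V} (h : G.IsP4Set W) : InducesP4 G W := by
  obtain ⟨a, b, c, d, h, rfl⟩ := h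
  obtain ⟨n1, n2, n3, n4, n5, n6⟩ := h.ne
  obtain ⟨h1, h2, h3, h4, h5, h6⟩ := h
  have key : ∀ i : Fin 4, ![a, b, c, d] i ∈ ({a, b, c, d} : Set V) := by
    intro i
    fin_cases i <;> simp
  refine ⟨Iso.symm ⟨Equiv.ofBijective (fun i => ⟨![a, b, c, d] i, key i⟩) ⟨?_, ?_⟩, ?_⟩⟩
  · intro i j
    fin_cases i <;> fin_cases j <;> simp [*, Ne.symm]
  · rintro ⟨x, rfl | rfl | rfl | rfl⟩
    exacts [⟨0, rfl⟩, ⟨1, rfl⟩, ⟨2, rfl⟩, ⟨3, rfl⟩]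
  · intro i j
    change G.Adj (![a, b, c, d] i) (![a, b, c, d] j) ↔ _
    fin_cases i <;> fin_cases j <;> simp [pathGraph_adj] <;> grind [G.adj_comm]

/-- At most one vertex outside of a given `P₄` lies in a `P₄` that meets the given one. -/
def IsExtendible (G : SimpleGraph V) : Prop :=
  ∀ W U U' : Set V, G.IsP4Set W → G.IsP4Set U → G.IsP4Set U' → (U ∩ W).Nonempty →
    (U' ∩ W).Nonempty → ∀ v ∈ U, v ∉ W → ∀ v' ∈ U', v' ∉ W → v = v'

theorem _root_.IsP4Extendible.isExtendible {G : SimpleGraph V} (h : IsP4Extendible G) :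
    G.IsExtendible :=
  fun W U U' hW hU hU' h1 h2 _ hv hvW _ hv' hvW' => h W hW.inducesP4
    ⟨hvW, U, hU.inducesP4, hv, h1⟩ ⟨hvW', U', hU'.inducesP4, hv', h2⟩

theorem IsExtendible.compl {G : SimpleGraph V} (h : G.IsExtendible) : Gᶜ.IsExtendible :=
  fun W U U' hW hU hU' => h W U U' (by simpa using hW.compl) (by simpa using hU.compl)
    (by simpa using hU'.compl)

theorem IsExtendible.comap {G : SimpleGraph V} {F : SimpleGraph W} (h : G.IsExtendible)
    (f : F ↪g G) : F.IsExtendible := by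
  have key : ∀ S, F.IsP4Set S → G.IsP4Set (f '' S) := by
    rintro S ⟨a, b, c, d, hP, rfl⟩
    refine ⟨f a, f b, f c, f d, ?_, by simp [Set.image_insert_eq]⟩
    simpa only [IsP4, f.map_adj_iff] using hP
  intro S U U' hS hU hU' h1 h2 v hv hvS v' hv' hvS'
  refine f.injective (h _ _ _ (key S hS) (key U hU) (key U' hU') ?_ ?_ _ ⟨v, hv, rfl⟩ ?_ _
    ⟨v', hv', rfl⟩ ?_)
  · obtain ⟨x, hx, hx'⟩ := h1
    exact ⟨f x, ⟨x, hx, rfl⟩, ⟨x, hx', rfl⟩⟩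
  · obtain ⟨x, hx, hx'⟩ := h2
    exact ⟨f x, ⟨x, hx, rfl⟩, ⟨x, hx', rfl⟩⟩
  · simpa [f.injective.mem_set_image] using hvS
  · simpa [f.injective.mem_set_image] using hvS'

/-- A module of a connected and co-connected graph is seen by an induced `P₄` outside of it as the
nose of a bull, or each of its vertices lies on a `P₄` that leaves the module. -/
theorem exists_isP4_of_module [Finite V] {G : SimpleGraph V} (hG : G.NoCut) (hG' : Gᶜ.NoCut)
    {Z : Set V} (hZ : Zᶜ.Nonempty) {z : V} (hz : z ∈ Z)
    (hmod : ∀ v ∉ Z, ∀ w ∈ Z, (G.Adj v w ↔ G.Adj v z)) :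
    (∃ a ∉ Z, ∃ b ∉ Z, ∃ c ∉ Z, ∃ d ∉ Z, G.IsP4 a b c d ∧
      ¬ G.Adj a z ∧ G.Adj b z ∧ G.Adj c z ∧ ¬ G.Adj d z) ∨
    ∃ b ∉ Z, ∃ c ∉ Z, ∃ d ∉ Z, G.IsP4 z b c d ∨ G.IsP4 b z c d := by
  by_contra hn
  rw [not_or] at hn
  obtain ⟨hn1, hn2⟩ := hn
  push Not at hn2
  -- Outside `Z`, let $T$ be the neighbours of `z` and $N$ the non-neighbours. With no $P_4$ leaving
  -- `Z` through `z`, adjacent vertices of $N$ have the same neighbours in $T$ (`F1`), and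
  -- nonadjacent vertices of $T$ have the same neighbours in $N$ (`F2`).
  have F1 : ∀ n ∉ Z, ∀ n' ∉ Z, ∀ t ∉ Z, ¬ G.Adj n z → ¬ G.Adj n' z → G.Adj t z → G.Adj n n' →
      G.Adj t n → G.Adj t n' := by
    intro n hn n' hn' t ht h1 h2 h3 h4 h5
    by_contra h6
    exact (hn2 t ht n hn n' hn').1 ⟨h3.symm, h5, h4, fun h => h1 h.symm, fun h => h2 h.symm, h6⟩
  have F2 : ∀ n ∉ Z, ∀ t ∉ Z, ∀ t' ∉ Z, ¬ G.Adj n z → G.Adj t z → G.Adj t' z → ¬ G.Adj t t' →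
      G.Adj t n → G.Adj t' n := by
    intro n hn t ht t' ht' h1 h2 h3 h4 h5
    by_contra h6
    exact (hn2 t' ht' t ht n hn).2 ⟨h3, h2.symm, h5, fun h => h4 h.symm, h6, fun h => h1 h.symm⟩
  have hT : {t | t ∉ Z ∧ G.Adj t z}.Nonempty := by
    obtain ⟨x, hx, y, hy, hxy⟩ := hG Z ⟨z, hz⟩ hZ
    exact ⟨y, hy, (hmod y hy x hx).1 hxy.symm⟩
  -- By `F1`, no edge leaves the set of vertices of $N$ without a neighbour in $T$, so connectedness
  -- makes it empty.
  have hN : ∀ n ∉ Z, ¬ G.Adj n z → ∃ t ∉ Z, G.Adj t z ∧ G.Adj t n := by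
    by_contra hN
    push Not at hN
    obtain ⟨n, hn, hnz, hnt⟩ := hN
    obtain ⟨x, hx, y, hy, hxy⟩ := hG {n | n ∉ Z ∧ ¬ G.Adj n z ∧ ∀ t ∉ Z, G.Adj t z → ¬ G.Adj t n}
      ⟨n, hn, hnz, hnt⟩ ⟨z, fun h => h.1 hz⟩
    simp only [Set.mem_ofPred_eq, Set.mem_compl_iff] at hx hy
    obtain ⟨hx1, hx2, hx3⟩ := hx
    have hyZ : y ∉ Z := fun h => hx2 ((hmod x hx1 y h).1 hxy)
    have hyz : ¬ G.Adj y z := fun h => hx3 y hyZ h hxy.symm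
    refine hy ⟨hyZ, hyz, fun t ht htz hty => ?_⟩
    exact hx3 t ht htz (F1 y hyZ x hx1 t ht hyz hx2 htz hxy.symm hty)
  obtain ⟨t, ⟨htZ, htz⟩, htmax⟩ := Set.exists_max_image _
    (fun t => {n | n ∉ Z ∧ ¬ G.Adj n z ∧ G.Adj t n}.ncard) (Set.toFinite _) hT
  -- Some vertex of $T$ misses part of $N$: by `F2`, the vertices of $T$ that see all of $N$ would
  -- be cut off in the complement.
  by_cases hall : ∀ n ∉ Z, ¬ G.Adj n z → G.Adj t n
  · obtain ⟨x, hx, y, hy, hxy⟩ := hG' {t | t ∉ Z ∧ G.Adj t z ∧ ∀ n ∉ Z, ¬ G.Adj n z → G.Adj t n}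
      ⟨t, htZ, htz, hall⟩ ⟨z, fun h => h.1 hz⟩
    simp only [Set.mem_ofPred_eq, Set.mem_compl_iff] at hx hy
    obtain ⟨hx1, hx2, hx3⟩ := hx
    have hxy' : ¬ G.Adj x y := hxy.2
    have hyZ : y ∉ Z := fun h => hxy' ((hmod x hx1 y h).2 hx2)
    have hyz : G.Adj y z := by_contra fun h => hxy' (hx3 y hyZ h)
    exact hy ⟨hyZ, hyz, fun n hn hnz => F2 n hn x hx1 y hyZ hnz hx2 hyz hxy' (hx3 n hn hnz)⟩
  · push Not at hall
    obtain ⟨n', hn', hnz', htn'⟩ := hall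
    obtain ⟨t', ht', htz', htn2⟩ := hN n' hn' hnz'
    -- By maximality of `t`, the neighbourhoods of `t` and `t'` in $N$ are incomparable, which makes
    -- `n, t, t', n'` the $P_4$ of a bull with nose `z`.
    obtain ⟨n, hn, hnz, htn, htn3⟩ : ∃ n ∉ Z, ¬ G.Adj n z ∧ G.Adj t n ∧ ¬ G.Adj t' n := by
      by_contra hc
      push Not at hc
      refine (htmax t' ⟨ht', htz'⟩).not_gt (Set.ncard_lt_ncard ⟨?_, ?_⟩ (Set.toFinite _))
      · exact fun n hn => ⟨hn.1, hn.2.1, hc n hn.1 hn.2.1 hn.2.2⟩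
      · exact fun h => htn' (h (show n' ∈ _ from ⟨hn', hnz', htn2⟩)).2.2
    refine hn1 ⟨n, hn, t, htZ, t', ht', n', hn', ⟨htn.symm, ?_, htn2, fun h => htn3 h.symm, ?_,
      htn'⟩, hnz, htz, htz', hnz'⟩
    · by_contra h
      exact htn3 (F2 n hn t htZ t' ht' hnz htz htz' h htn)
    · exact fun h => htn' (F1 n hn n' hn' t htZ hnz hnz' htz h htn)

/-! ### The structure of connected and co-connected extendible graphs -/

/-- The vertex `v` lies on a `P₄` that meets `W`. -/
def Crosses (G : SimpleGraph V) (W : Set V) (v : V) : Prop :=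
  ∃ U, G.IsP4Set U ∧ v ∈ U ∧ (U ∩ W).Nonempty

/-- The vertex `v` is adjacent to all, to none, or exactly to the two midpoints of `a, b, c, d`. -/
def SeesUniformly (G : SimpleGraph V) (a b c d v : V) : Prop :=
  (G.Adj v a ∧ G.Adj v b ∧ G.Adj v c ∧ G.Adj v d) ∨
  (¬ G.Adj v a ∧ ¬ G.Adj v b ∧ ¬ G.Adj v c ∧ ¬ G.Adj v d) ∨
  (¬ G.Adj v a ∧ G.Adj v b ∧ G.Adj v c ∧ ¬ G.Adj v d)

/-- Each of the other thirteen adjacency patterns creates a $P_4$ through `v`. The two groups of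
four are mirror images, so later only one orientation needs treatment. -/
theorem IsP4.seesUniformly_or {G : SimpleGraph V} {a b c d : V} (h : G.IsP4 a b c d) (v : V) :
    G.SeesUniformly a b c d v ∨
    (G.IsP4 v b c d ∨ G.IsP4 v a b c ∨ G.IsP4 a v c d ∨ G.IsP4 a v d c) ∨
    (G.IsP4 v c b a ∨ G.IsP4 v d c b ∨ G.IsP4 d v b a ∨ G.IsP4 d v a b) := by
  obtain ⟨h1, h2, h3, h4, h5, h6⟩ := h
  simp only [SeesUniformly, IsP4, G.adj_comm d v, G.adj_comm a v, G.adj_comm b a, G.adj_comm c b,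
    G.adj_comm d c, G.adj_comm c a, G.adj_comm d a, G.adj_comm d b, h1, h2, h3, h4, h5, h6]
  by_cases G.Adj v a <;> by_cases G.Adj v b <;> by_cases G.Adj v c <;> by_cases G.Adj v d <;>
    simp [*]

theorem IsP4.seesUniformly {G : SimpleGraph V} {a b c d v : V} (h : G.IsP4 a b c d)
    (hv : ¬ G.Crosses {a, b, c, d} v) : G.SeesUniformly a b c d v := by
  refine (h.seesUniformly_or v).resolve_right ?_
  have key : ∀ p q r s, G.IsP4 p q r s → v ∈ ({p, q, r, s} : Set V) →
      ¬ (({p, q, r, s} : Set V) ∩ {a, b, c, d}).Nonempty :=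
    fun p q r s h1 h2 h3 => hv ⟨_, ⟨p, q, r, s, h1, rfl⟩, h2, h3⟩
  rintro ((h | h | h | h) | (h | h | h | h)) <;> refine key _ _ _ _ h (by simp) ?_
  exacts [⟨b, by simp⟩, ⟨b, by simp⟩, ⟨a, by simp⟩, ⟨a, by simp⟩, ⟨b, by simp⟩, ⟨b, by simp⟩,
    ⟨a, by simp⟩, ⟨a, by simp⟩]

/-- On its own $P_4$, `y` has a neighbour and a non-neighbour, so it does not see all or none. If it
saw just the midpoints, an endpoint `y` would have adjacent non-neighbours among `a`, `d`, and a
midpoint `y` nonadjacent neighbours among `b`, `c`. -/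
theorem IsP4.not_seesUniformly {G : SimpleGraph V} {a b c d y p q r s : V} (h : G.IsP4 a b c d)
    (h' : G.IsP4 p q r s) (hy : y ∈ ({p, q, r, s} : Set V))
    (hW : ∀ x ∈ ({p, q, r, s} : Set V), x = y ∨ x ∈ ({a, b, c, d} : Set V)) :
    ¬ G.SeesUniformly a b c d y := by
  have hn := h'.ne
  wlog hpq : y = p ∨ y = q generalizing p q r s
  · refine this h'.symm ?_ ?_ h'.symm.ne ?_
    · simp only [Set.mem_insert_iff, Set.mem_singleton_iff] at hy ⊢
      tauto
    · intro x hx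
      refine hW x ?_
      simp only [Set.mem_insert_iff, Set.mem_singleton_iff] at hx ⊢
      tauto
    · simp only [Set.mem_insert_iff, Set.mem_singleton_iff] at hy
      tauto
  simp only [Set.mem_insert_iff, Set.mem_singleton_iff, forall_eq_or_imp, forall_eq] at hW
  obtain ⟨h1, h2, h3, h4, h5, h6⟩ := h
  obtain ⟨g1, g2, g3, g4, g5, g6⟩ := h'
  obtain ⟨n1, n2, n3, n4, n5, n6⟩ := hn
  obtain ⟨w1, w2, w3, w4⟩ := hW
  rcases hpq with rfl | rfl
  · have w2 := w2.resolve_left n1.symm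
    have w3 := w3.resolve_left n2.symm
    have w4 := w4.resolve_left n3.symm
    rintro (⟨u1, u2, u3, u4⟩ | ⟨u1, u2, u3, u4⟩ | ⟨u1, u2, u3, u4⟩)
    · rcases w3 with rfl | rfl | rfl | rfl <;> contradiction
    · rcases w2 with rfl | rfl | rfl | rfl <;> contradiction
    · have := h5
      rcases w3 with rfl | rfl | rfl | rfl <;> rcases w4 with rfl | rfl | rfl | rfl <;>
        first | contradiction | exact h5 g3.symm
  · have w1 := w1.resolve_left n1
    have w3 := w3.resolve_left n4.symm
    have w4 := w4.resolve_left n5.symm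
    rintro (⟨u1, u2, u3, u4⟩ | ⟨u1, u2, u3, u4⟩ | ⟨u1, u2, u3, u4⟩)
    · rcases w4 with rfl | rfl | rfl | rfl <;> contradiction
    · rcases w3 with rfl | rfl | rfl | rfl <;> contradiction
    · have g1' := g1.symm
      rcases w1 with rfl | rfl | rfl | rfl <;> rcases w3 with rfl | rfl | rfl | rfl <;>
        first | contradiction | exact g4 h2.symm

/-- This makes the component of a $P_4$ well behaved. If the $P_4$ through `v` missed `W`, then `v`
and a vertex of `W` off `U` would be two distinct outside vertices on $P_4$s meeting `U`. -/
theorem IsExtendible.crosses_trans {G : SimpleGraph V} (hG : G.IsExtendible) {W U : Set V} {v : V}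
    (hW : G.IsP4Set W) (hU : G.IsP4Set U) (hUW : (U ∩ W).Nonempty) (hv : G.Crosses U v) :
    G.Crosses W v := by
  obtain ⟨X, hX, hvX, u, huX, huU⟩ := hv
  by_contra hn
  have hXW : ∀ x ∈ X, x ∉ W := fun x hx hxW => hn ⟨X, hX, hvX, x, hx, hxW⟩
  have hvU : v ∉ U := fun h => hn ⟨U, hU, h, hUW⟩
  obtain ⟨w, hwW, hwU⟩ : ∃ w ∈ W, w ∉ U := by
    by_contra h
    push Not at h
    have : W = U := Set.eq_of_subset_of_ncard_le h (by rw [hW.ncard_eq, hU.ncard_eq]) hU.finite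
    exact hXW u huX (this ▸ huU)
  have := hG U X W hU hX hW ⟨u, huX, huU⟩ (by rwa [Set.inter_comm]) v hvX hvU w hwW hwU
  exact hXW v hvX (this ▸ hwW)

theorem IsP4.isP4Set {G : SimpleGraph V} {a b c d : V} (h : G.IsP4 a b c d) :
    G.IsP4Set {a, b, c, d} :=
  ⟨a, b, c, d, h, rfl⟩

/-- A vertex off the component of a `P₄` sees each vertex of the component as it sees the `P₄`, if
it sees the `P₄` completely or not at all. -/
theorem IsExtendible.adj_iff_of_crosses {G : SimpleGraph V} (hG : G.IsExtendible) {a b c d : V}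
    (h : G.IsP4 a b c d) {v z : V} (hv : ¬ G.Crosses {a, b, c, d} v)
    (hz : G.Crosses {a, b, c, d} z) {P : Prop}
    (hP : ∀ x ∈ ({a, b, c, d} : Set V), (G.Adj v x ↔ P)) : G.Adj v z ↔ P := by
  by_cases hzW : z ∈ ({a, b, c, d} : Set V)
  · exact hP z hzW
  obtain ⟨U, hU, hzU, hUW⟩ := hz
  have hvU : ¬ G.Crosses U v := fun h' => hv (hG.crosses_trans h.isP4Set hU hUW h')
  -- Three vertices of `U` lie on the given path, so `v` sees them alike. Seeing only the midpoints
  -- of `U` would not be constant on any three of its vertices, hence `z` is seen in the same way.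
  have hUz : ∀ x ∈ U, x = z ∨ x ∈ ({a, b, c, d} : Set V) := by
    intro x hx
    by_contra hc
    rw [not_or] at hc
    exact hc.1 (hG _ U U h.isP4Set hU hU hUW hUW x hx hc.2 z hzU hzW)
  obtain ⟨p, q, r, s, h', rfl⟩ := hU
  have hs := h'.seesUniformly hvU
  obtain ⟨n1, n2, n3, n4, n5, n6⟩ := h'.ne
  have key : ∀ x ∈ ({p, q, r, s} : Set V), x ≠ z → (G.Adj v x ↔ P) :=
    fun x hx hxz => hP x ((hUz x hx).resolve_left hxz)
  have kp := key p (by simp)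
  have kq := key q (by simp)
  have kr := key r (by simp)
  have ks := key s (by simp)
  unfold SeesUniformly at hs
  rcases hzU with rfl | rfl | rfl | rfl <;> grind

/-- The vertices that see exactly the midpoints of the path `a, b, c, d`. -/
def partialVertices (G : SimpleGraph V) (a b c d : V) : Set V :=
  {v | ¬ G.Adj v a ∧ G.Adj v b ∧ G.Adj v c ∧ ¬ G.Adj v d}

/-- This shows that the component together with the partial vertices is a module: a discrepancy at a
partial vertex `z` would give a $P_4$ through `v` and `a`. -/
theorem IsExtendible.adj_iff_of_notMem {G : SimpleGraph V} (hG : G.IsExtendible) {a b c d : V}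
    (h : G.IsP4 a b c d) {v z : V} (hv : ¬ G.Crosses {a, b, c, d} v)
    (hv' : v ∉ G.partialVertices a b c d)
    (hz : G.Crosses {a, b, c, d} z ∨ z ∈ G.partialVertices a b c d) :
    G.Adj v z ↔ G.Adj v a := by
  have hP : ∀ x ∈ ({a, b, c, d} : Set V), (G.Adj v x ↔ G.Adj v a) := by
    rcases h.seesUniformly hv with ⟨h1, h2, h3, h4⟩ | ⟨h1, h2, h3, h4⟩ | h1
    · rintro x (rfl | rfl | rfl | rfl) <;> simp [*]
    · rintro x (rfl | rfl | rfl | rfl) <;> simp [*]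
    · exact absurd h1 hv'
  rcases hz with hz | ⟨z1, z2, z3, z4⟩
  · exact hG.adj_iff_of_crosses h hv hz hP
  have hb := hP b (by simp)
  have hc := hP c (by simp)
  have hvn : ∀ p q r s, G.IsP4 p q r s → v ∈ ({p, q, r, s} : Set V) → a ∉ ({p, q, r, s} : Set V) :=
    fun p q r s h1 h2 h3 => hv ⟨_, h1.isP4Set, h2, a, h3, by simp⟩
  constructor
  · intro hvz
    by_contra hva
    exact hvn v z b a ⟨hvz, z2, h.1.symm, fun h' => hva (hb.1 h'), hva, z1⟩ (by simp) (by simp)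
  · intro hva
    by_contra hvz
    exact hvn a v c z ⟨hva.symm, hc.2 hva, z3.symm, h.2.2.2.1, fun h' => z1 h'.symm, hvz⟩
      (by simp) (by simp)

/-- In a connected and co-connected extendible graph, some `P₄` is such that all vertices outside
of its component see exactly its midpoints. -/
theorem IsExtendible.exists_isP4 [Finite V] [Nontrivial V] {G : SimpleGraph V}
    (hE : G.IsExtendible) (hG : G.NoCut) (hG' : Gᶜ.NoCut) :
    ∃ a b c d, G.IsP4 a b c d ∧
      ∀ v, ¬ G.Crosses {a, b, c, d} v → v ∈ G.partialVertices a b c d := by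
  obtain ⟨a₀, b₀, c₀, d₀, h₀⟩ : ∃ a b c d, G.IsP4 a b c d := by
    obtain ⟨z, w, hzw⟩ := exists_pair_ne V
    rcases exists_isP4_of_module hG hG' (Z := {z}) ⟨w, hzw.symm⟩ rfl (by simp) with
      ⟨a, -, b, -, c, -, d, -, h, -⟩ | ⟨b, -, c, -, d, -, h | h⟩
    exacts [⟨_, _, _, _, h⟩, ⟨_, _, _, _, h⟩, ⟨_, _, _, _, h⟩]
  -- Maximality handles the bull outcome for the module `Z`: the new path has all of `Z` as partial
  -- vertices, including `a`, hence strictly more. A $P_4$ leaving `Z` through `a` would put an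
  -- outside vertex into the component.
  obtain ⟨⟨a, b, c, d⟩, h, hmax⟩ := Set.exists_max_image
    {t : V × V × V × V | G.IsP4 t.1 t.2.1 t.2.2.1 t.2.2.2}
    (fun t => (G.partialVertices t.1 t.2.1 t.2.2.1 t.2.2.2).ncard) (Set.toFinite _)
    ⟨(a₀, b₀, c₀, d₀), h₀⟩
  replace h : G.IsP4 a b c d := h
  refine ⟨a, b, c, d, h, ?_⟩
  by_contra hn
  push Not at hn
  obtain ⟨v, hv, hv'⟩ := hn
  obtain ⟨Z, hZ⟩ : ∃ Z, Z = {z | G.Crosses {a, b, c, d} z ∨ z ∈ G.partialVertices a b c d} :=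
    ⟨_, rfl⟩
  have hWZ : ∀ x ∈ ({a, b, c, d} : Set V), x ∈ Z := fun x hx => by
    rw [hZ]
    exact Or.inl ⟨_, h.isP4Set, hx, x, hx, hx⟩
  have hmod : ∀ v ∉ Z, ∀ w ∈ Z, (G.Adj v w ↔ G.Adj v a) := by
    intro v hv w hw
    rw [hZ] at hv hw
    exact hE.adj_iff_of_notMem h (fun h' => hv (Or.inl h')) (fun h' => hv (Or.inr h')) hw
  have haZ : a ∈ Z := hWZ a (by simp)
  have hvZ : v ∉ Z := by
    rw [hZ]
    rintro (h' | h')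
    exacts [hv h', hv' h']
  rcases exists_isP4_of_module hG hG' (Z := Z) ⟨v, hvZ⟩ haZ hmod with
    ⟨p, hp, q, hq, r, hr, s, hs, h', h1, h2, h3, h4⟩ | ⟨p, hp, q, hq, r, hr, h'⟩
  · refine (hmax (p, q, r, s) h').not_gt (Set.ncard_lt_ncard ⟨?_, ?_⟩ (Set.toFinite _))
    · intro w hw
      have hwZ : w ∈ Z := by
        rw [hZ]
        exact Or.inr hw
      change w ∈ G.partialVertices p q r s
      simp only [partialVertices, Set.mem_ofPred_eq, G.adj_comm w, hmod p hp w hwZ,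
        hmod q hq w hwZ, hmod r hr w hwZ, hmod s hs w hwZ]
      exact ⟨h1, h2, h3, h4⟩
    · intro hsub
      have : a ∈ G.partialVertices a b c d := hsub (show a ∈ G.partialVertices p q r s from
        ⟨fun h' => h1 h'.symm, h2.symm, h3.symm, fun h' => h4 h'.symm⟩)
      exact h.2.2.2.1 this.2.2.1
  · refine hp ?_
    rw [hZ]
    rcases h' with h' | h'
    · exact Or.inl ⟨_, h'.isP4Set, by simp, a, by simp, by simp⟩
    · exact Or.inl ⟨_, h'.isP4Set, by simp, a, by simp, by simp⟩

/-- Either `V = {a, b, c, d, y}`, or `y` is a twin of the endpoint `a` or of the midpoint `b` and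
all further vertices see exactly the midpoints. -/
def IsSpread (G : SimpleGraph V) (a b c d y : V) : Prop :=
  G.IsP4 a b c d ∧ ((∀ v, v ∈ ({a, b, c, d, y} : Set V)) ∨
    (G.IsP4 y b c d ∧ ∀ v, v ∉ ({a, b, c, d, y} : Set V) →
      v ∈ G.partialVertices a b c d ∧ ¬ G.Adj v y) ∨
    (G.IsP4 a y c d ∧ ∀ v, v ∉ ({a, b, c, d, y} : Set V) →
      v ∈ G.partialVertices a b c d ∧ G.Adj v y))

theorem partialVertices_symm {G : SimpleGraph V} {a b c d : V} :
    G.partialVertices d c b a = G.partialVertices a b c d := by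
  ext v
  simp only [partialVertices, Set.mem_ofPred_eq]
  tauto

theorem IsExtendible.exists_isSpread [Finite V] [Nontrivial V] {G : SimpleGraph V}
    (hE : G.IsExtendible) (hG : G.NoCut) (hG' : Gᶜ.NoCut) :
    ∃ a b c d y, G.IsSpread a b c d y := by
  obtain ⟨a, b, c, d, h, hR⟩ := hE.exists_isP4 hG hG'
  have hW : ∀ x ∈ ({a, b, c, d} : Set V), G.Crosses {a, b, c, d} x :=
    fun x hx => ⟨_, h.isP4Set, hx, x, hx, hx⟩
  by_cases hC : ∀ v, G.Crosses {a, b, c, d} v → v ∈ ({a, b, c, d} : Set V)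
  -- Without a fifth vertex in the component, `y := a` serves as a degenerate twin.
  · refine ⟨a, b, c, d, a, h, Or.inr (Or.inl ⟨h, fun v hv => ?_⟩)⟩
    have : v ∈ G.partialVertices a b c d := by
      refine hR v fun hvC => hv ?_
      rcases hC v hvC with rfl | rfl | rfl | rfl <;> simp
    exact ⟨this, this.1⟩
  push Not at hC
  obtain ⟨y, ⟨U, hU, hyU, hUW⟩, hyW⟩ := hC
  have hUy : ∀ x, G.Crosses {a, b, c, d} x → x = y ∨ x ∈ ({a, b, c, d} : Set V) := by
    rintro x ⟨U', hU', hx, hUW'⟩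
    by_contra hc
    rw [not_or] at hc
    exact hc.1 (hE _ U' U h.isP4Set hU' hU hUW' hUW x hx hc.2 y hyU hyW)
  have hny : ¬ G.SeesUniformly a b c d y := by
    obtain ⟨p, q, r, s, h', rfl⟩ := hU
    exact h.not_seesUniformly h' hyU fun x hx => hUy x ⟨_, h'.isP4Set, hx, hUW⟩
  have hyc : G.Crosses {a, b, c, d} y := ⟨U, hU, hyU, hUW⟩
  have hsee : ∀ v, v ∉ ({a, b, c, d, y} : Set V) → v ∈ G.partialVertices a b c d ∧
      ∀ p q r s, G.IsP4 p q r s → (({p, q, r, s} : Set V) ∩ {a, b, c, d}).Nonempty →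
        G.SeesUniformly p q r s v := by
    intro v hv
    have hv' : ¬ G.Crosses {a, b, c, d} v := by
      intro h'
      refine hv ?_
      rcases hUy v h' with rfl | (rfl | rfl | rfl | rfl) <;> simp
    exact ⟨hR v hv', fun p q r s h1 h2 => h1.seesUniformly fun h3 =>
      hv' (hE.crosses_trans h.isP4Set h1.isP4Set h2 h3)⟩
  have main : ∀ a b c d, G.IsP4 a b c d → (∀ v, v ∉ ({a, b, c, d, y} : Set V) →
      v ∈ G.partialVertices a b c d ∧ ∀ p q r s, G.IsP4 p q r s →
        (({p, q, r, s} : Set V) ∩ {a, b, c, d}).Nonempty → G.SeesUniformly p q r s v) →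
      (G.IsP4 y b c d ∨ G.IsP4 y a b c ∨ G.IsP4 a y c d ∨ G.IsP4 a y d c) →
      G.IsSpread a b c d y := by
    clear hsee hny hyc hUy hUW hyU hyW hU hW hR h
    intro a b c d h hsee hy
    refine ⟨h, or_iff_not_imp_left.2 fun hall => ?_⟩
    push Not at hall
    obtain ⟨w, hw⟩ := hall
    obtain ⟨⟨w1, w2, w3, w4⟩, hwu⟩ := hsee w hw
    -- The outer vertex `w` sees `b` and `c` but not `a` or `d`, which is not uniform on `y, a, b,
    -- c` or `a, y, d, c`. The other two paths determine how outer vertices see `y`.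
    rcases hy with hy | hy | hy | hy
    · refine Or.inl ⟨hy, fun v hv => ⟨(hsee v hv).1, ?_⟩⟩
      obtain ⟨⟨v1, v2, v3, v4⟩, hvu⟩ := hsee v hv
      have := hvu _ _ _ _ hy ⟨b, by simp, by simp⟩
      unfold SeesUniformly at this
      tauto
    · have := hwu _ _ _ _ hy ⟨b, by simp, by simp⟩
      unfold SeesUniformly at this
      tauto
    · refine Or.inr ⟨hy, fun v hv => ⟨(hsee v hv).1, ?_⟩⟩
      obtain ⟨⟨v1, v2, v3, v4⟩, hvu⟩ := hsee v hv
      have := hvu _ _ _ _ hy ⟨c, by simp, by simp⟩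
      unfold SeesUniformly at this
      tauto
    · have := hwu _ _ _ _ hy ⟨d, by simp, by simp⟩
      unfold SeesUniformly at this
      tauto
  rcases (h.seesUniformly_or y).resolve_left hny with hy | hy
  · exact ⟨a, b, c, d, y, main a b c d h hsee hy⟩
  · have hset : ({d, c, b, a} : Set V) = {a, b, c, d} := by
      ext x
      simp only [Set.mem_insert_iff, Set.mem_singleton_iff]
      tauto
    refine ⟨d, c, b, a, y, main d c b a h.symm ?_ hy⟩
    intro v hv
    rw [partialVertices_symm, hset]
    refine hsee v fun hv' => hv ?_
    simp only [Set.mem_insert_iff, Set.mem_singleton_iff] at hv' ⊢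
    tauto

/-! ### Monopolar and polar covers of spreads -/

theorem IsClusterOn.union {G : SimpleGraph V} {A B : Set V} (hA : G.IsClusterOn A)
    (hB : G.IsClusterOn B) (h : ∀ x ∈ A, ∀ y ∈ B, ¬ G.Adj x y) : G.IsClusterOn (A ∪ B) := by
  rintro x (hx | hx) y (hy | hy) z (hz | hz) h1 h2 h3
  · exact hA x hx y hy z hz h1 h2 h3
  · exact absurd h2 (h y hy z hz)
  · exact absurd h1 (h x hx y hy)
  · exact absurd h1 (h x hx y hy)
  · exact absurd h1.symm (h y hy x hx)
  · exact absurd h1.symm (h y hy x hx)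
  · exact absurd h2.symm (h z hz y hy)
  · exact hB x hx y hy z hz h1 h2 h3

theorem IsMultipartiteOn.union {G : SimpleGraph V} {A B : Set V} (hA : G.IsMultipartiteOn A)
    (hB : G.IsMultipartiteOn B) (h : ∀ x ∈ A, ∀ y ∈ B, G.Adj x y) :
    G.IsMultipartiteOn (A ∪ B) := by
  rw [← isClusterOn_compl] at *
  exact hA.union hB fun x hx y hy h' => h'.2 (h x hx y hy)

/-- In the complement `b` and `c` are nonadjacent and miss `R`. There a $2K_2$ of `R` becomes
$C_4+2K_1$, a $C_4$ becomes $K_1+2K_2$ and a $C_5$ becomes $K_1+C_5$. -/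
theorem containsEssential_compl_of_join {G : SimpleGraph V} {R : Set V} (hfin : R.Finite) {b c : V}
    (hbc : G.Adj b c) (hR : ∀ v ∈ R, G.Adj v b ∧ G.Adj v c) (hs : ¬ G.SplitOn R) :
    Gᶜ.ContainsEssential := by
  by_contra hn
  have hb : ∀ v ∈ R, ¬ Gᶜ.Adj b v := fun v hv h => h.2 (hR v hv).1.symm
  have hc : ∀ v ∈ R, ¬ Gᶜ.Adj c v := fun v hv h => h.2 (hR v hv).2.symm
  refine hs (splitOn_of_finite hfin ?_ ?_ ?_)
  · intro p hp q hq r hr s hs h1 h2 h3 h4 h5 h6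
    refine hn (containsEssential_of_isC4_of_two_isolated (a := p) (b := r) (c := q) (d := s) (i := b) (j := c) ?_
      hbc.ne (fun h => h.2 hbc) ⟨hb p hp, hb r hr, hb q hq, hb s hs⟩
      ⟨hc p hp, hc r hr, hc q hq, hc s hs⟩)
    have := h1.ne
    have := h2.ne
    simp only [IsC4, compl_adj]
    grind [G.adj_comm]
  · intro p hp q hq r hr s hs h1 h2 h3 h4 h5 h6 h7 h8
    exact hn (containsEssential_of_two_edges (i := b) (a := p) (b := r) (c := q) (d := s)
      ⟨hb p hp, hb r hr, hb q hq, hb s hs⟩ ⟨h5, h7⟩ ⟨h6, h8⟩ (fun h => h.2 h1)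
      (fun h => h.2 h4.symm) (fun h => h.2 h2.symm) (fun h => h.2 h3))
  · intro p hp q hq r hr s hs t ht h1 h2 h3 h4 h5 g1 g2 g3 g4 g5
    refine hn (containsEssential_of_isolated_of_C5 (i := b) (a := p) (b := r) (c := t) (d := q) (e := s)
      ⟨hb p hp, hb r hr, hb t ht, hb q hq, hb s hs⟩ ?_ ?_ ?_ ?_ ?_ ?_ ?_ ?_ ?_ ?_) <;>
    simp only [compl_adj] <;> grind [G.adj_comm]

theorem monopolarOn_univ_of_isP4 {G : SimpleGraph V} {a b c d y : V} (h : G.IsP4 a b c d)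
    (hV : ∀ v, v ∈ ({a, b, c, d, y} : Set V)) : G.MonopolarOn Set.univ := by
  obtain ⟨h1, h2, h3, h4, h5, h6⟩ := h
  by_cases hyc : G.Adj y c
  · by_cases hyb : G.Adj y b
    · refine ⟨{a, d}, {b, c, y}, fun v _ => ?_, ?_, IsClique.isClusterOn ?_⟩
      · have := hV v
        simp only [Set.mem_union, Set.mem_insert_iff, Set.mem_singleton_iff] at *
        tauto
      · rintro x (rfl | rfl) z (rfl | rfl) hxz <;> grind [G.adj_comm]
      · rintro x (rfl | rfl | rfl) z (rfl | rfl | rfl) hxz <;> grind [G.adj_comm]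
    · refine ⟨{a, c}, {d, y} ∪ {b}, fun v _ => ?_, ?_,
        IsClusterOn.union ?_ (by rintro x rfl y rfl z rfl; simp) ?_⟩
      · have := hV v
        simp only [Set.mem_union, Set.mem_insert_iff, Set.mem_singleton_iff] at *
        tauto
      · rintro x (rfl | rfl) z (rfl | rfl) hxz <;> grind [G.adj_comm]
      · rintro x (rfl | rfl) z (rfl | rfl) w (rfl | rfl) <;> grind [G.adj_comm]
      · rintro x (rfl | rfl) z rfl <;> grind [G.adj_comm]
  · refine ⟨{b, d}, {a, y} ∪ {c}, fun v _ => ?_, ?_,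
      IsClusterOn.union ?_ (by rintro x rfl y rfl z rfl; simp) ?_⟩
    · have := hV v
      simp only [Set.mem_union, Set.mem_insert_iff, Set.mem_singleton_iff] at *
      tauto
    · rintro x (rfl | rfl) z (rfl | rfl) hxz <;> grind [G.adj_comm]
    · rintro x (rfl | rfl) z (rfl | rfl) w (rfl | rfl) <;> grind [G.adj_comm]
    · rintro x (rfl | rfl) z rfl <;> grind [G.adj_comm]

theorem monopolarOn_univ_of_split {G : SimpleGraph V} {R H₁ H₂ : Set V} (hR : G.SplitOn R)
    (hu : Set.univ ⊆ R ∪ (H₁ ∪ H₂)) (h₁ : G.IsClique H₁) (h₂ : G.IsIndepSet H₂)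
    (hR₁ : ∀ v ∈ R, ∀ x ∈ H₁, G.Adj v x) (hR₂ : ∀ v ∈ R, ∀ x ∈ H₂, ¬ G.Adj v x) :
    G.MonopolarOn Set.univ := by
  obtain ⟨K, I, hKI, hK, hI⟩ := hR
  refine ⟨(I ∩ R) ∪ H₂, (K ∩ R) ∪ H₁, ?_, ?_, IsClique.isClusterOn ?_⟩
  · intro v hv
    have h1 := hu hv
    have h2 := @hKI v
    simp only [Set.mem_union, Set.mem_inter_iff] at *
    tauto
  · rintro x (hx | hx) y (hy | hy) hxy h
    · exact hI hx.1 hy.1 hxy h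
    · exact hR₂ x hx.2 y hy h
    · exact hR₂ y hy.2 x hx h.symm
    · exact h₂ hx hy hxy h
  · rintro x (hx | hx) y (hy | hy) hxy
    · exact hK hx.1 hy.1 hxy
    · exact hR₁ x hx.2 y hy
    · exact (hR₁ y hy.2 x hx).symm
    · exact h₁ hx hy hxy

/-- With no essential graph in the complement, `R` is split. The split partition extends unless `y`
is adjacent to its endpoint twin or nonadjacent to its midpoint twin. Then `R` is a clique and fits
into one clique of the cluster with `c`, since a non-edge of `R` would give an essential graph in
the complement. -/
theorem IsSpread.monopolarOn_or [Finite V] {G : SimpleGraph V} {a b c d y : V}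
    (h : G.IsSpread a b c d y) : G.MonopolarOn Set.univ ∨ Gᶜ.ContainsEssential := by
  refine or_iff_not_imp_right.2 fun hn => ?_
  obtain ⟨hP, h⟩ := h
  have hP' := hP
  obtain ⟨h1, h2, h3, h4, h5, h6⟩ := hP
  obtain ⟨R, hRd⟩ : ∃ R, R = ({a, b, c, d, y} : Set V)ᶜ := ⟨_, rfl⟩
  have hcov : ∀ v, v ∈ R ∨ v ∈ ({a, b, c, d, y} : Set V) := fun v => by
    rw [hRd, or_comm]
    exact em _
  have hsplit : (∀ v ∈ R, v ∈ G.partialVertices a b c d) → G.SplitOn R := fun hR => by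
    by_contra hs
    exact hn (containsEssential_compl_of_join (Set.toFinite R) h2
      (fun v hv => ⟨(hR v hv).2.1, (hR v hv).2.2.1⟩) hs)
  rcases h with h | ⟨⟨g1, g2, g3, g4, g5, g6⟩, h⟩ | ⟨⟨g1, g2, g3, g4, g5, g6⟩, h⟩
  · exact monopolarOn_univ_of_isP4 hP' h
  · have hR : ∀ v ∈ R, v ∈ G.partialVertices a b c d ∧ ¬ G.Adj v y := fun v hv =>
      h v (by rw [hRd] at hv; exact hv)
    by_cases hay : G.Adj a y
    · by_cases hK : G.IsClique R
      · refine ⟨{b, d}, {a, y} ∪ insert c R, fun v _ => ?_, ?_, IsClusterOn.union ?_ ?_ ?_⟩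
        · have := hcov v
          simp only [Set.mem_union, Set.mem_insert_iff, Set.mem_singleton_iff] at *
          tauto
        · rintro x (rfl | rfl) z (rfl | rfl) hxz <;> grind [G.adj_comm]
        · rintro x (rfl | rfl) z (rfl | rfl) w (rfl | rfl) <;> grind [G.adj_comm]
        · exact (hK.insert fun v hv _ => (hR v hv).1.2.2.1.symm).isClusterOn
        · rintro x hx z (rfl | hz) hxz
          · rcases hx with rfl | rfl <;> contradiction
          · rcases hx with rfl | rfl
            · exact (hR z hz).1.1 hxz.symm
            · exact (hR z hz).2 hxz.symm
      · simp only [IsClique, Set.Pairwise] at hK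
        push Not at hK
        obtain ⟨r, hr, s, hs, hrs, hrs'⟩ := hK
        obtain ⟨⟨r1, r2, r3, r4⟩, r5⟩ := hR r hr
        obtain ⟨⟨s1, s2, s3, s4⟩, s5⟩ := hR s hs
        have hne : ∀ x ∈ R, x ≠ a ∧ x ≠ y := by
          rintro x hx
          rw [hRd] at hx
          simp only [Set.mem_compl_iff, Set.mem_insert_iff, Set.mem_singleton_iff] at hx
          tauto
        refine (hn (containsEssential_of_isC4_of_adj_three (i := b) (a := a) (b := s) (c := y) (d := c) (v := r)
          ?_ ?_ ?_ ?_ ?_ ?_)).elim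
        · have := hne s hs
          have := hP'.ne
          have := hay.ne
          have := s3.ne
          clear h hR hcov hne hsplit hRd
          simp only [IsC4, compl_adj]
          grind [G.adj_comm]
        all_goals
          have := hne r hr
          simp only [compl_adj]
          grind [G.adj_comm]
    · refine monopolarOn_univ_of_split (R := R) (H₁ := {b, c}) (H₂ := {a, d, y})
        (hsplit fun v hv => (hR v hv).1) (fun v _ => ?_) ?_ ?_ ?_ ?_
      · have := hcov v
        simp only [Set.mem_union, Set.mem_insert_iff, Set.mem_singleton_iff] at *
        tauto
      · rintro x (rfl | rfl) z (rfl | rfl) hxz <;> grind [G.adj_comm]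
      · rintro x (rfl | rfl | rfl) z (rfl | rfl | rfl) hxz <;> grind [G.adj_comm]
      · rintro v hv x (rfl | rfl)
        exacts [(hR v hv).1.2.1, (hR v hv).1.2.2.1]
      · rintro v hv x (rfl | rfl | rfl)
        exacts [(hR v hv).1.1, (hR v hv).1.2.2.2, (hR v hv).2]
  · have hR : ∀ v ∈ R, v ∈ G.partialVertices a b c d ∧ G.Adj v y := fun v hv =>
      h v (by rw [hRd] at hv; exact hv)
    by_cases hyb : y = b ∨ G.Adj y b
    · refine monopolarOn_univ_of_split (R := R) (H₁ := {b, c, y}) (H₂ := {a, d})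
        (hsplit fun v hv => (hR v hv).1) (fun v _ => ?_) ?_ ?_ ?_ ?_
      · have := hcov v
        simp only [Set.mem_union, Set.mem_insert_iff, Set.mem_singleton_iff] at *
        tauto
      · rintro x (rfl | rfl | rfl) z (rfl | rfl | rfl) hxz <;> grind [G.adj_comm]
      · rintro x (rfl | rfl) z (rfl | rfl) hxz <;> grind [G.adj_comm]
      · rintro v hv x (rfl | rfl | rfl)
        exacts [(hR v hv).1.2.1, (hR v hv).1.2.2.1, (hR v hv).2]
      · rintro v hv x (rfl | rfl)
        exacts [(hR v hv).1.1, (hR v hv).1.2.2.2]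
    · rw [not_or] at hyb
      obtain ⟨hyb, hyb'⟩ := hyb
      by_cases hK : G.IsClique R
      · refine ⟨{b, y, d}, {a} ∪ insert c R, fun v _ => ?_, ?_, IsClusterOn.union ?_ ?_ ?_⟩
        · have := hcov v
          simp only [Set.mem_union, Set.mem_insert_iff, Set.mem_singleton_iff] at *
          tauto
        · rintro x (rfl | rfl | rfl) z (rfl | rfl | rfl) hxz <;> grind [G.adj_comm]
        · rintro x rfl y rfl z rfl
          simp
        · exact (hK.insert fun v hv _ => (hR v hv).1.2.2.1.symm).isClusterOn
        · rintro x rfl z (rfl | hz) hxz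
          · exact h4 hxz
          · exact (hR z hz).1.1 hxz.symm
      · simp only [IsClique, Set.Pairwise] at hK
        push Not at hK
        obtain ⟨r, hr, s, hs, hrs, hrs'⟩ := hK
        obtain ⟨⟨r1, r2, r3, r4⟩, r5⟩ := hR r hr
        obtain ⟨⟨s1, s2, s3, s4⟩, s5⟩ := hR s hs
        refine (hn (containsEssential_of_two_edges (i := c) (a := b) (b := y) (c := r) (d := s)
          ?_ ?_ ?_ ?_ ?_ ?_ ?_)).elim
        all_goals
          simp only [compl_adj]
          grind [G.adj_comm]

theorem PolarOn.univ_of_join {G : SimpleGraph V} {R H₁ H₂ : Set V} (hR : G.PolarOn R)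
    (hu : Set.univ ⊆ R ∪ (H₁ ∪ H₂)) (h₁ : G.IsMultipartiteOn H₁) (h₂ : G.IsClusterOn H₂)
    (hR₁ : ∀ v ∈ R, ∀ x ∈ H₁, G.Adj v x) (hR₂ : ∀ v ∈ R, ∀ x ∈ H₂, ¬ G.Adj v x) :
    G.PolarOn Set.univ := by
  obtain ⟨A, B, hAB, hA, hB⟩ := hR
  refine ⟨(A ∩ R) ∪ H₁, (B ∩ R) ∪ H₂, ?_,
    (hA.mono Set.inter_subset_left).union h₁ fun x hx => hR₁ x hx.2,
    (hB.mono Set.inter_subset_left).union h₂ fun x hx => hR₂ x hx.2⟩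
  intro v hv
  have h1 := hu hv
  have h2 := @hAB v
  simp only [Set.mem_union, Set.mem_inter_iff] at *
  tauto

/-- The adjacency of `y` with its twin is irrelevant here: the midpoints are complete multipartite
and the endpoints a cluster either way. -/
theorem IsSpread.polarOn {G : SimpleGraph V} {a b c d y : V} (h : G.IsSpread a b c d y)
    (hpol : ∀ S : Set V, S ≠ Set.univ → G.PolarOn S) : G.PolarOn Set.univ := by
  obtain ⟨hP, h⟩ := h
  have hP' := hP
  obtain ⟨h1, h2, h3, h4, h5, h6⟩ := hP
  have hpol := hpol ({a, b, c, d, y} : Set V)ᶜ fun h' => by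
    have : a ∈ ({a, b, c, d, y} : Set V)ᶜ := h' ▸ Set.mem_univ a
    simp at this
  rcases h with h | ⟨⟨g1, g2, g3, g4, g5, g6⟩, h⟩ | ⟨⟨g1, g2, g3, g4, g5, g6⟩, h⟩
  · exact (monopolarOn_univ_of_isP4 hP' h).polarOn
  · refine hpol.univ_of_join (H₁ := {b, c}) (H₂ := {a, y} ∪ {d}) (fun v _ => ?_) ?_
      (IsClusterOn.union ?_ (by rintro x rfl y rfl z rfl; simp) ?_) ?_ ?_
    · simp only [Set.mem_union, Set.mem_compl_iff, Set.mem_insert_iff, Set.mem_singleton_iff]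
      tauto
    · rintro x (rfl | rfl) z (rfl | rfl) w (rfl | rfl) <;> grind [G.adj_comm]
    · rintro x (rfl | rfl) z (rfl | rfl) w (rfl | rfl) <;> grind [G.adj_comm]
    · rintro x (rfl | rfl) z rfl <;> assumption
    · rintro v hv x (rfl | rfl)
      exacts [(h v hv).1.2.1, (h v hv).1.2.2.1]
    · rintro v hv x ((rfl | rfl) | rfl)
      exacts [(h v hv).1.1, (h v hv).2, (h v hv).1.2.2.2]
  · refine hpol.univ_of_join (H₁ := {b, y} ∪ {c}) (H₂ := {a, d}) (fun v _ => ?_)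
      (IsMultipartiteOn.union ?_ (by rintro x rfl y rfl z rfl; simp) ?_) ?_ ?_ ?_
    · simp only [Set.mem_union, Set.mem_compl_iff, Set.mem_insert_iff, Set.mem_singleton_iff]
      tauto
    · rintro x (rfl | rfl) z (rfl | rfl) w (rfl | rfl) <;> grind [G.adj_comm, G.irrefl]
    · rintro x (rfl | rfl) z rfl <;> assumption
    · rintro x (rfl | rfl) z (rfl | rfl) w (rfl | rfl) <;> grind [G.adj_comm]
    · rintro v hv x ((rfl | rfl) | rfl)
      exacts [(h v hv).1.2.1, (h v hv).2, (h v hv).1.2.2.1]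
    · rintro v hv x (rfl | rfl)
      exacts [(h v hv).1.1, (h v hv).1.2.2.2]

theorem MonopolarOn.map {G : SimpleGraph V} {F : SimpleGraph W} {S : Set W}
    (h : F.MonopolarOn S) (f : F ↪g G) : G.MonopolarOn (f '' S) := by
  obtain ⟨A, B, hu, hA, hB⟩ := h
  refine ⟨f '' A, f '' B, by rw [← Set.image_union]; exact Set.image_mono hu, ?_, ?_⟩
  · rintro _ ⟨x, hx, rfl⟩ _ ⟨y, hy, rfl⟩ hxy h
    exact hA hx hy (fun h' => hxy (h' ▸ rfl)) (f.map_adj_iff.1 h)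
  · rintro _ ⟨x, hx, rfl⟩ _ ⟨y, hy, rfl⟩ _ ⟨z, hz, rfl⟩ h1 h2 h3
    exact f.map_adj_iff.2 (hB _ hx _ hy _ hz (f.map_adj_iff.1 h1) (f.map_adj_iff.1 h2)
      (fun h' => h3 (h' ▸ rfl)))

theorem MonopolarOn.union {G : SimpleGraph V} {S T : Set V} (hS : G.MonopolarOn S)
    (hT : G.MonopolarOn T) (h : ∀ x ∈ S, ∀ y ∈ T, ¬ G.Adj x y) : G.MonopolarOn (S ∪ T) := by
  obtain ⟨A, B, hu, hA, hB⟩ := hS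
  obtain ⟨A', B', hu', hA', hB'⟩ := hT
  refine ⟨(A ∩ S) ∪ (A' ∩ T), (B ∩ S) ∪ (B' ∩ T), ?_, ?_, ?_⟩
  · rintro v (hv | hv)
    · have := hu hv
      simp only [Set.mem_union, Set.mem_inter_iff] at *
      tauto
    · have := hu' hv
      simp only [Set.mem_union, Set.mem_inter_iff] at *
      tauto
  · rintro x (hx | hx) y (hy | hy) hxy h'
    · exact hA hx.1 hy.1 hxy h'
    · exact h x hx.2 y hy.2 h'
    · exact h y hy.2 x hx.2 h'.symm
    · exact hA' hx.1 hy.1 hxy h'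
  · exact (hB.mono Set.inter_subset_left).union (hB'.mono Set.inter_subset_left)
      fun x hx y hy => h x hx.2 y hy.2

/-! ### Minimal obstructions -/

theorem not_noCut_iff {G : SimpleGraph V} : ¬ G.NoCut ↔
    ∃ S : Set V, S.Nonempty ∧ Sᶜ.Nonempty ∧ ∀ x ∈ S, ∀ y ∈ Sᶜ, ¬ G.Adj x y := by
  simp only [NoCut]
  push Not
  rfl

/-- The extendible minimal obstructions to monopolarity are the complements of the essential
graphs. -/
theorem IsExtendible.exists_iso_compl [Finite V] {G : SimpleGraph V} (hE : G.IsExtendible)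
    (hG : ¬ G.MonopolarOn Set.univ) (hmin : ∀ S : Set V, S ≠ Set.univ → G.MonopolarOn S) :
    ∃ (W : Type) (F : SimpleGraph W), IsEssentialGraph F ∧ Nonempty (Fᶜ ≃g G) := by
  obtain ⟨W, F, hF, ⟨f⟩⟩ : Gᶜ.ContainsEssential := by
    by_cases h1 : G.NoCut
    · by_cases h2 : Gᶜ.NoCut
      · have : Nontrivial V := by
          by_contra hV
          rw [not_nontrivial_iff_subsingleton] at hV
          exact hG ⟨Set.univ, ∅, by simp, fun x _ y _ hxy => absurd (Subsingleton.elim x y) hxy,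
            fun x hx => hx.elim⟩
        obtain ⟨a, b, c, d, y, h⟩ := hE.exists_isSpread h1 h2
        exact h.monopolarOn_or.resolve_left hG
      · obtain ⟨S, hS, hS', hcut⟩ := not_noCut_iff.1 h2
        exact containsEssential_of_cut hS hS' hcut (by rwa [compl_compl])
    · obtain ⟨S, hS, hS', hcut⟩ := not_noCut_iff.1 h1
      refine absurd ?_ hG
      rw [← Set.union_compl_self S]
      refine (hmin S fun h => ?_).union (hmin Sᶜ fun h => ?_) hcut
      · exact hS'.ne_empty (by rw [h, Set.compl_univ])
      · exact hS.ne_empty (by rw [← compl_compl S, h, Set.compl_univ])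
  refine ⟨W, F, hF, ?_⟩
  have hadj : ∀ x y, G.Adj (f x) (f y) ↔ Fᶜ.Adj x y := fun x y => by
    have h1 := f.map_adj_iff (v := x) (w := y)
    have h2 := f.injective.ne_iff (x := x) (y := y)
    rw [compl_adj] at h1 ⊢
    have h3 : G.Adj (f x) (f y) → f x ≠ f y := fun h => h.ne
    tauto
  let g : Fᶜ ↪g G := ⟨f.toEmbedding, hadj _ _⟩
  -- A proper copy of `Fᶜ` would be monopolar by minimality, against `not_monopolarOn_compl`.
  have hsurj : Set.range g = Set.univ := by
    by_contra h
    have := (hmin _ h).comap g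
    rw [Set.preimage_range] at this
    exact not_monopolarOn_compl hF this
  exact ⟨⟨Equiv.ofBijective g ⟨g.injective, Set.range_eq_univ.1 hsurj⟩, hadj _ _⟩⟩

/-- The disconnected extendible minimal polar obstructions. -/
theorem IsExtendible.exists_iso_sum [Finite V] {H : SimpleGraph V} (hE : H.IsExtendible)
    (hmin : IsMinimalPolarObstruction H) (hcut : ¬ H.NoCut) :
    ∃ (W : Type) (E : SimpleGraph W), IsEssentialGraph E ∧
      Nonempty (H ≃g pathGraph 3 ⊕g Eᶜ) := by
  obtain ⟨hnp, hpol⟩ := hmin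
  rw [isPolar_iff] at hnp
  simp only [isPolar_induce_iff] at hpol
  obtain ⟨X, hX', hXc, hXm⟩ : ∃ X : Set V, Xᶜ.Nonempty ∧ (∀ x ∈ X, ∀ y ∈ Xᶜ, ¬ H.Adj x y) ∧
      ¬ H.MonopolarOn X := by
    obtain ⟨S, hS, hS', hc⟩ := not_noCut_iff.1 hcut
    by_cases h1 : H.MonopolarOn S
    · refine ⟨Sᶜ, by rwa [compl_compl], fun x hx y hy h => ?_, fun h2 => hnp ?_⟩
      · rw [compl_compl] at hy
        exact hc y hy x hx h.symm
      · rw [← Set.union_compl_self S]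
        exact (h1.union h2 hc).polarOn
    · exact ⟨S, hS', hc, h1⟩
  obtain ⟨p, hp, q, hq, r, hr, hpq, hqr, hpr, hpr'⟩ : ∃ p ∈ Xᶜ, ∃ q ∈ Xᶜ, ∃ r ∈ Xᶜ,
      H.Adj p q ∧ H.Adj q r ∧ p ≠ r ∧ ¬ H.Adj p r := by
    by_contra hn
    push Not at hn
    obtain ⟨A, B, hAB, hA, hB⟩ := hpol X fun h => hX'.ne_empty (by rw [h, Set.compl_univ])
    refine hnp ⟨A, (B ∩ X) ∪ Xᶜ, fun v _ => ?_, hA,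
      (hB.mono Set.inter_subset_left).union hn fun x hx => hXc x hx.2⟩
    have := @hAB v
    simp only [Set.mem_union, Set.mem_inter_iff, Set.mem_compl_iff] at *
    tauto
  have hXp : ∀ x ∈ X, ¬ H.Adj x p ∧ ¬ H.Adj x q ∧ ¬ H.Adj x r :=
    fun x hx => ⟨hXc x hx p hp, hXc x hx q hq, hXc x hx r hr⟩
  -- An edge of `S` inside the multipartite part would force `p`, `q`, `r` out of it, since each
  -- would form $K_1+K_2$ with the edge. The cluster would then contain a $P_3$.
  have key : ∀ S ⊆ X, H.PolarOn (S ∪ {p, q, r}) → H.MonopolarOn S := by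
    rintro S hS ⟨A, B, hAB, hA, hB⟩
    refine ⟨A ∩ S, B, fun v hv => ?_, fun x hx y hy hxy h => ?_, hB⟩
    · rcases hAB (Or.inl hv) with h | h
      exacts [Or.inl ⟨h, hv⟩, Or.inr h]
    · have hx' := hXp x (hS hx.2)
      have hy' := hXp y (hS hy.2)
      have hnA : ∀ z ∈ A, ¬ H.Adj x z → ¬ H.Adj y z → False := fun z hz h1 h2 =>
        hA x hx.1 z hz y hy.1 h1 (fun h3 => h2 h3.symm) h
      have hpB : p ∈ B := (hAB (Or.inr (by simp))).resolve_left fun h' => hnA p h' hx'.1 hy'.1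
      have hqB : q ∈ B := (hAB (Or.inr (by simp))).resolve_left fun h' => hnA q h' hx'.2.1 hy'.2.1
      have hrB : r ∈ B := (hAB (Or.inr (by simp))).resolve_left fun h' => hnA r h' hx'.2.2 hy'.2.2
      exact hpr' (hB p hpB q hqB r hrB hpq hqr hpr)
  have huniv : X ∪ {p, q, r} = Set.univ := by
    by_contra h
    exact hXm (key X subset_rfl (hpol _ h))
  have hsub : ∀ S ⊆ X, S ≠ X → H.MonopolarOn S := by
    intro S hS hne
    refine key S hS (hpol _ fun h => hne (hS.antisymm fun x hx => ?_))
    have : x ∈ S ∪ {p, q, r} := h ▸ Set.mem_univ x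
    rcases this with h' | rfl | rfl | rfl
    exacts [h', absurd hx hp, absurd hx hq, absurd hx hr]
  obtain ⟨W, E, hEs, ⟨e⟩⟩ := (hE.comap (Embedding.induce (G := H) X)).exists_iso_compl
    (fun h => hXm (by
      have := h.map (Embedding.induce (G := H) X)
      rwa [Set.image_univ, show Set.range (Embedding.induce (G := H) X) = X from
        Subtype.range_val] at this))
    (fun S hS => by
      have := (hsub (Subtype.val '' S) (by simp) fun h => hS ?_).comap (Embedding.induce (G := H) X)
      · rwa [show Subtype.val '' S = (Embedding.induce (G := H) X) '' S from rfl,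
          Set.preimage_image_eq _ (RelEmbedding.injective _)] at this
      · rw [Set.eq_univ_iff_forall]
        intro x
        have : x.1 ∈ Subtype.val '' S := h.symm ▸ x.2
        simpa using this)
  refine ⟨W, E, hEs, ?_⟩
  have hadj : ∀ x y, H.Adj (e x) (e y) ↔ Eᶜ.Adj x y := fun x y => e.map_adj_iff
  have hnadj : ∀ x, ¬ H.Adj (e x) p ∧ ¬ H.Adj (e x) q ∧ ¬ H.Adj (e x) r := fun x => hXp _ (e x).2
  have hpne := hpq.ne
  have hqne := hqr.ne
  have hinj : Function.Injective (Sum.elim ![p, q, r] fun x => (e x : V)) := by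
    have hne : ∀ (i : Fin 3) (x : W), ![p, q, r] i ≠ e x := by
      intro i x h
      have := (e x).2
      rw [← h] at this
      fin_cases i
      exacts [hp this, hq this, hr this]
    rintro (i | x) (j | y) h
    · revert h
      fin_cases i <;> fin_cases j <;> simp [*, Ne.symm]
    · exact absurd h (hne i y)
    · exact absurd h.symm (hne j x)
    · exact congrArg _ (e.injective (Subtype.ext h))
  have hsurj : Function.Surjective (Sum.elim ![p, q, r] fun x => (e x : V)) := by
    intro v
    have : v ∈ X ∪ {p, q, r} := huniv ▸ Set.mem_univ v
    rcases this with hv | rfl | rfl | rfl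
    · obtain ⟨x, hx⟩ := e.surjective ⟨v, hv⟩
      exact ⟨Sum.inr x, congrArg Subtype.val hx⟩
    exacts [⟨Sum.inl 0, rfl⟩, ⟨Sum.inl 1, rfl⟩, ⟨Sum.inl 2, rfl⟩]
  refine ⟨Iso.symm ⟨Equiv.ofBijective _ ⟨hinj, hsurj⟩, ?_⟩⟩
  rintro (i | x) (j | y)
  · change H.Adj (![p, q, r] i) (![p, q, r] j) ↔ _
    fin_cases i <;> fin_cases j <;> simp [pathGraph_adj, *, H.adj_comm q p, H.adj_comm r]
  · change H.Adj (![p, q, r] i) (e y) ↔ _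
    rw [H.adj_comm]
    have := hnadj y
    fin_cases i <;> simp [*]
  · change H.Adj (e x) (![p, q, r] j) ↔ _
    have := hnadj x
    fin_cases j <;> simp [*]
  · change H.Adj (e x) (e y) ↔ _
    rw [hadj]
    simp

theorem _root_.IsMinimalPolarObstruction.compl {H : SimpleGraph V}
    (h : IsMinimalPolarObstruction H) : IsMinimalPolarObstruction Hᶜ := by
  obtain ⟨h1, h2⟩ := h
  rw [isPolar_iff] at h1
  simp only [isPolar_induce_iff] at h2
  refine ⟨fun h => h1 ?_, fun S hS => ?_⟩
  · have := (isPolar_iff.1 h).compl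
    rwa [compl_compl] at this
  · exact isPolar_induce_iff.2 (h2 S hS).compl

end SimpleGraph

theorem mainTheorem10 {V : Type*} [Finite V] (H : SimpleGraph V)
    (hext : IsP4Extendible H) (hmin : IsMinimalPolarObstruction H) :
    ∃ (W : Type) (E : SimpleGraph W), IsEssentialGraph E ∧
      (Nonempty (H ≃g SimpleGraph.pathGraph 3 ⊕g Eᶜ) ∨
        Nonempty (Hᶜ ≃g SimpleGraph.pathGraph 3 ⊕g Eᶜ)) := by
  have hE := hext.isExtendible
  by_cases h1 : H.NoCut
  · by_cases h2 : Hᶜ.NoCut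
    · obtain ⟨hnp, hpol⟩ := hmin
      rw [SimpleGraph.isPolar_iff] at hnp
      simp only [SimpleGraph.isPolar_induce_iff] at hpol
      have : Nontrivial V := by
        by_contra hV
        rw [not_nontrivial_iff_subsingleton] at hV
        refine hnp ⟨Set.univ, ∅, by simp, fun x _ y _ z _ _ _ h => ?_, fun x hx => hx.elim⟩
        exact h.ne (Subsingleton.elim x z)
      obtain ⟨a, b, c, d, y, h⟩ := hE.exists_isSpread h1 h2
      exact absurd (h.polarOn hpol) hnp
    · obtain ⟨W, E, hEs, h⟩ := hE.compl.exists_iso_sum hmin.compl h2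
      exact ⟨W, E, hEs, Or.inr h⟩
  · obtain ⟨W, E, hEs, h⟩ := hE.exists_iso_sum hmin h1
    exact ⟨W, E, hEs, Or.inl h⟩
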